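/- Let $M(s)$ be a real rational function (the open loop: controller times vehicle, written in lowest terms as $M=n/d$) with at least one integrator, i.e. with a pole at $s=0$. Consider a platoon of $N\ge 2$ vehicles $1,\dots,N$ (vehicle $1$ is the leader) with positions $y_i$ and external inputs $r_i$, where $y_i=M(s)e_i$, $e_1=r_1$, $e_i=(y_{i-1}-y_i)-\epsilon_i(y_i-y_{i+1})+r_i$ for $1<i<N$, $e_N=(y_{N-1}-y_N)+r_N$, and $\epsilon_i\ge 0$. Let $L$ be its Laplacian, so that $e=-Ly+r$; let $T_{c,o}(s)$ be the transfer function from $r_c$ to $y_o$, that is, the $(o,c)$ entry of $M(s)(I+M(s)L)^{-1}$, and let $d_{c,o}=|c-o|$. For a transfer function $T$ put $\|T\|_\infty=\sup_{\omega\ge 0}|T(\jmath\omega)|\in[0,\infty]$. Let $0<\lambda_{\min}\le\lambda_{\max}$ be such that, for every $\lambda\in[\lambda_{\min},\lambda_{\max}]$, all roots of the polynomial $d+\lambda n$ lie in the open left half-plane, and let $T_{\min}=\dfrac{\lambda_{\min}M}{1+\lambda_{\min}M}$. If $\|T_{\min}\|_\infty>1$, then there are constants $0<\xi\le 1$ and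 $\zeta>1$, depending only on $\lambda_{\min}$, $\lambda_{\max}$ and $M$, such that for every $N\ge 2$ and all $\epsilon_i\ge0$ for which the nonzero eigenvalues of $L$ lie in $[\lambda_{\min},\lambda_{\max}]$, and for all $c,o\in\{2,\dots,N\}$ such that $\epsilon_i>0$ for every $i$ with $o\le i<c$ (no condition if $c\le o$), $$\|T_{c,o}\|_\infty>\zeta^{d_{c,o}}\,T_{c,o}(0)\,\xi^2 .$$ Moreover, the condition $\|T_{\min}\|_\infty>1$ holds whenever $M$ has at least two integrators, i.e. a pole of order at least $2$ at $s=0$. -/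

import Mathlib

open scoped ENNReal Polynomial

namespace Platoon

noncomputable section

/-- A real polynomial all of whose complex roots lie in the open left half-plane. -/
def IsStable (p : ℝ[X]) : Prop :=
  ∀ s : ℂ, Polynomial.aeval s p = 0 → s.re < 0

/-- The number of integrators of an open loop `M`: the order of its pole at `0`, that is the `η`
with `M = s ^ (-η) * M'`, `M'` finite and nonzero at `0` (and `η = 0` if `M` has no pole at `0`). -/
def numIntegrators (M : RatFunc ℝ) : ℕ :=
  M.denom.rootMultiplicity 0

/-- The value at the complex frequency `s` of a real rational transfer function. -/
def evalAt (T : RatFunc ℝ) (s : ℂ) : ℂ :=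
  T.eval (algebraMap ℝ ℂ) s

/-- The steady-state gain `T(0)`. -/
def steadyStateGain (T : RatFunc ℝ) : ℝ :=
  T.eval (RingHom.id ℝ) 0

/-- The norm `‖T‖_∞ = sup_{ω ≥ 0} |T(jω)|`, as an element of `[0, ∞]`. -/
def hinfNorm (T : RatFunc ℝ) : ℝ≥0∞ :=
  ⨆ ω : ℝ, ⨆ _ : 0 ≤ ω, ‖evalAt T (Complex.I * (ω : ℂ))‖ₑ

/-- The single-agent closed loop `k M / (1 + k M)` with proportional gain `k`. -/
def closedLoop (M : RatFunc ℝ) (k : ℝ) : RatFunc ℝ :=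
  (RatFunc.C k * M) / (1 + RatFunc.C k * M)

/-- The Laplacian of a platoon of `N` vehicles. The index `i : Fin N` stands for the vehicle
`i + 1`, so that `0` is the leader and `N - 1` the trailing vehicle; `ε i` is the constant of
bidirectionality (unused for the leader and the trailing vehicle). -/
def laplacian (N : ℕ) (ε : Fin N → ℝ) : Matrix (Fin N) (Fin N) ℝ :=
  Matrix.of fun i j =>
    if (i : ℕ) = 0 then 0
    else if (j : ℕ) + 1 = i then -1
    else if j = i then (if (i : ℕ) + 1 = N then 1 else 1 + ε i)
    else if (j : ℕ) = i + 1 then -ε i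
    else 0

/-- The matrix of transfer functions from the external inputs `r` to the positions `y`, where
`y = M e` and `e = -L y + r`, that is `(1 + M L) y = M r`. -/
def transferMatrix (M : RatFunc ℝ) (N : ℕ) (ε : Fin N → ℝ) :
    Matrix (Fin N) (Fin N) (RatFunc ℝ) :=
  M • (1 + M • (laplacian N ε).map RatFunc.C)⁻¹

/-- The transfer function from the input of the vehicle `c` to the position of the vehicle `o`. -/
def transfer (M : RatFunc ℝ) (N : ℕ) (ε : Fin N → ℝ) (c o : Fin N) : RatFunc ℝ :=
  transferMatrix M N ε o c

/-- The number of edges between `c` and `o` in the path graph. -/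
def graphDist {N : ℕ} (c o : Fin N) : ℕ :=
  Nat.dist (c : ℕ) (o : ℕ)

end

end Platoon

/-!
Write `w = 1 / M(jω)` and number the vehicles behind the leader by `1, …, n`. Without the leader,
`w + L` is tridiagonal, so `T_{c,o}(jω)` is a quotient of determinants of blocks of it (`transfer_eq`):
up to the factor `∏ ε i`, which also occurs in `T_{c,o}(0)`, it is the determinant of the vehicles in
front of the path from `c` to `o`, times that of the vehicles behind it, divided by the full
determinant. A block is *cut* if the edge to the vehicle behind it is removed, so that it is itself
a platoon; determinants of cut blocks have the value `1` at `w = 0` (`cutBlock_at_zero`).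

Removing the edges at both ends of the path turns the full determinant into a product of three cut
blocks. Each removal costs at most a constant factor independent of `n`
(`IsPivotSet.norm_cutBlock_add_le`), and so does putting back the edge between the path and the
vehicles in front of it (`IsPivotSet.norm_cutBlock_le_block`), because the pivots of Gaussian
elimination are bounded away from `0`: if `w` is not real, their imaginary parts have the sign of
`w.im` and at least its modulus. What remains is the cut block of the path, the product of `(w + l) / l` over its eigenvalues `l`, one for
each of its `d + 1` vehicles (`pow_mul_norm_cutBlock_le_one`). If `|T_min(jω)| > 1`, then
`|w + lmin| < lmin`, and by the triangle inequality all `l` in `[lmin, lmax]` satisfy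
`|w + l| ≤ l / ζ` with a common `ζ > 1`; this gives the exponential growth.

The eigenvalues of cut blocks do lie in `[lmin, lmax]` (`cutBlock_root_mem`): positivity of the full
determinant on a half-line passes to the trailing blocks (`cont_tail_pos`), and from their pivots to
those of every other block by comparison (`cont_pos_of_compare`). The same pivots bound the leading
block at `w = 0`, which enters through `T_{c,o}(0)` (`lmin_mul_block_le_one`).

The frequency can be moved slightly to make `w` nonreal, unless `M` is even (`exists_frequency`). In
that case stability forces `lmin = lmax`, hence all `ε i` vanish and every pivot is `w + 1`.

For at least two integrators, `T_min - 1` vanishes at `0` to order at least two, which would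
contradict the maximum modulus principle on the right half-plane if `|T_min| ≤ 1` on the imaginary
axis (`one_lt_hinfNorm_of_two_le`).
-/

namespace Platoon

/-! ### Continuants of tridiagonal matrices -/

section Continuant

variable {R : Type*} [CommRing R]

/-- The determinant of the tridiagonal block on the indices `a, …, a + m - 1` with diagonal entries
`A i`, except that the last one is `Z (a + m - 1)`, subdiagonal entries `-1` and superdiagonal
entries `-E i` (in row `i`), as given by the expansion along the first row. The separate last
diagonal entry allows blocks of a platoon with the edge to the next vehicle removed. -/
def cont (A Z E : ℕ → R) : ℕ → ℕ → R
  | _, 0 => 1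
  | a, 1 => Z a
  | a, m + 2 => A a * cont A Z E (a + 1) (m + 1) - E a * cont A Z E (a + 2) m

variable (A Z E : ℕ → R)

@[simp] theorem cont_zero (a : ℕ) : cont A Z E a 0 = 1 := by rw [cont]

@[simp] theorem cont_one (a : ℕ) : cont A Z E a 1 = Z a := by rw [cont]

theorem cont_add_two (a m : ℕ) :
    cont A Z E a (m + 2) = A a * cont A Z E (a + 1) (m + 1) - E a * cont A Z E (a + 2) m := by
  rw [cont]

/-- Induction with two base cases, along the recursion of `cont` in the length. -/
theorem two_step_induction {P : ℕ → Prop} (h0 : P 0) (h1 : P 1)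
    (h : ∀ m, P m → P (m + 1) → P (m + 2)) (m : ℕ) : P m := by
  have : P m ∧ P (m + 1) := by
    induction m with
    | zero => exact ⟨h0, h1⟩
    | succ m ih => exact ⟨ih.2, h m ih.1 ih.2⟩
  exact this.1

theorem cont_congr {A' Z' E' : ℕ → R} (m : ℕ) : ∀ a, (∀ i, a ≤ i → A i = A' i) →
    (∀ i, a ≤ i → Z i = Z' i) → (∀ i, a ≤ i → E i = E' i) →
    cont A Z E a m = cont A' Z' E' a m := by
  induction m using two_step_induction with
  | h0 => intros; simp
  | h1 => intro a _ hZ _; simpa using hZ a le_rfl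
  | h m ih0 ih1 =>
    intro a hA hZ hE
    rw [cont_add_two, cont_add_two, hA a le_rfl, hE a le_rfl,
      ih1 (a + 1) (fun i hi => hA i (by omega)) (fun i hi => hZ i (by omega))
        (fun i hi => hE i (by omega)),
      ih0 (a + 2) (fun i hi => hA i (by omega)) (fun i hi => hZ i (by omega))
        (fun i hi => hE i (by omega))]

theorem map_cont {S : Type*} [CommRing S] (f : R →+* S) (m : ℕ) : ∀ a,
    f (cont A Z E a m) = cont (fun i => f (A i)) (fun i => f (Z i)) (fun i => f (E i)) a m := by
  induction m using two_step_induction with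
  | h0 => simp
  | h1 => simp
  | h m ih0 ih1 => intro a; rw [cont_add_two, cont_add_two]; simp [ih0, ih1]

theorem cont_neg (m : ℕ) : ∀ a,
    cont (fun i => -A i) (fun i => -Z i) E a m = (-1) ^ m * cont A Z E a m := by
  induction m using two_step_induction with
  | h0 => simp
  | h1 => simp
  | h m ih0 ih1 => intro a; rw [cont_add_two, cont_add_two, ih0, ih1]; ring

/-- Expansion of the determinant along the edge between `a + m` and `a + m + 1`. -/
theorem cont_split (l m : ℕ) : ∀ a, cont A Z E a (m + 1 + (l + 1)) =
    cont A A E a (m + 1) * cont A Z E (a + m + 1) (l + 1) -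
      E (a + m) * cont A A E a m * cont A Z E (a + m + 2) l := by
  induction m using two_step_induction with
  | h0 =>
    intro a
    rw [show 0 + 1 + (l + 1) = l + 2 by ring, cont_add_two]; simp
  | h1 =>
    intro a
    rw [show 1 + 1 + (l + 1) = l + 1 + 2 by ring, cont_add_two, cont_add_two,
      show a + 1 + 1 = a + 2 by ring, show a + 1 + 2 = a + 3 by ring,
      cont_add_two A A E a 0]
    simp only [cont_zero, cont_one, Nat.zero_add]
    ring
  | h m ih0 ih1 =>
    intro a
    have e1 := ih1 (a + 1)
    have e0 := ih0 (a + 2)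
    rw [show m + 2 + 1 + (l + 1) = (m + 1 + (l + 1)) + 2 by ring, cont_add_two,
      show m + 1 + (l + 1) + 1 = m + 1 + 1 + (l + 1) by ring, e1, e0,
      show m + 2 + 1 = m + 1 + 2 by ring, cont_add_two A A E a (m + 1), cont_add_two A A E a m,
      show a + 1 + (m + 1) = a + (m + 2) by ring, show a + 2 + m = a + (m + 2) by ring]
    ring

/-- Expansion of the determinant along its last row. -/
theorem cont_add_two' (a m : ℕ) : cont A Z E a (m + 2) =
    Z (a + m + 1) * cont A A E a (m + 1) - E (a + m) * cont A A E a m := by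
  have := cont_split A Z E 0 m a
  rw [show m + 2 = m + 1 + (0 + 1) by ring, this]; simp; ring

/-- Changing the last diagonal entry. -/
theorem cont_succ_sub (a m : ℕ) : cont A A E a (m + 1) =
    cont A Z E a (m + 1) + (A (a + m) - Z (a + m)) * cont A A E a m := by
  cases m with
  | zero => simp
  | succ m => rw [cont_add_two', cont_add_two' A Z]; ring_nf

end Continuant

section Pivots

variable {K : Type*} [Field K] (A Z E : ℕ → K) (S : Set K)

/-- If a set without `0` contains the last diagonal entries and is stable under the steps
`p ↦ A i - E i / p`, it contains all the pivots of the elimination that starts at the last row. -/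
theorem trailing_pivot_mem (h0 : (0 : K) ∉ S) (hZ : ∀ i, Z i ∈ S)
    (hS : ∀ i, ∀ p ∈ S, A i - E i / p ∈ S) (m : ℕ) : ∀ a,
    cont A Z E a m ≠ 0 ∧ cont A Z E a (m + 1) / cont A Z E (a + 1) m ∈ S := by
  induction m with
  | zero => intro a; simpa using hZ a
  | succ m ih =>
    intro a
    obtain ⟨h1, h2⟩ := ih (a + 1)
    have h3 : cont A Z E (a + 1) (m + 1) ≠ 0 := fun h => h0 (by simpa [h] using h2)
    refine ⟨fun h => h0 (by simpa [h] using (ih a).2), ?_⟩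
    have := hS a _ h2
    rw [cont_add_two]
    convert! this using 1
    have h4 := (ih (a + 2)).1
    simp only [show a + 1 + 1 = a + 2 by ring]
    field_simp

/-- The analogue of `trailing_pivot_mem` for the elimination that starts at the first row. -/
theorem leading_pivot_mem (h0 : (0 : K) ∉ S) (hA : ∀ i, A i ∈ S) (hZ : ∀ i, Z i ∈ S)
    (hS : ∀ i, ∀ p ∈ S, A (i + 1) - E i / p ∈ S) (hS' : ∀ i, ∀ p ∈ S, Z (i + 1) - E i / p ∈ S)
    (a m : ℕ) : cont A A E a m ≠ 0 ∧ cont A A E a (m + 1) / cont A A E a m ∈ S ∧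
      cont A Z E a (m + 1) / cont A A E a m ∈ S := by
  induction m with
  | zero => simpa using ⟨hA a, hZ a⟩
  | succ m ih =>
    obtain ⟨h1, h2, -⟩ := ih
    have h3 : cont A A E a (m + 1) ≠ 0 := fun h => h0 (by simpa [h] using h2)
    refine ⟨h3, ?_, ?_⟩
    · convert! hS (a + m) _ h2 using 1
      rw [cont_add_two' A A]; field_simp
    · convert! hS' (a + m) _ h2 using 1
      rw [cont_add_two' A Z]; field_simp

end Pivots


/-! ### Location of the roots of the blocks -/

section RealPivots

variable (A Z E : ℕ → ℝ)

/-- Under diagonal dominance all pivots are at least `1`. -/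
theorem cont_pos_of_one_le (hE : ∀ i, 0 ≤ E i) (hA : ∀ i, 1 + E i ≤ A i) (hZ : ∀ i, 1 ≤ Z i)
    (m : ℕ) : ∀ a, 0 < cont A Z E a m ∧ cont A Z E (a + 1) m ≤ cont A Z E a (m + 1) := by
  induction m with
  | zero => intro a; simpa using hZ a
  | succ m ih =>
    intro a
    have h0 := ih (a + 1)
    have h1 : 0 < cont A Z E (a + 1) (m + 1) :=
      lt_of_lt_of_le (ih (a + 2)).1 h0.2
    refine ⟨(ih (a + 1)).1.trans_le (ih a).2, ?_⟩
    rw [cont_add_two]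
    have h2 := h0.2
    rw [show a + 1 + 1 = a + 2 by ring] at h2
    nlinarith [mul_le_mul_of_nonneg_right (hA a) h1.le, mul_le_mul_of_nonneg_left h2 (hE a)]

/-- Comparison of pivots: a block that ends at `a + m` inherits positivity from a positive
sequence `k` with the same recursion whose last pivot `k (a + m) / k (a + m + 1)` is smaller. -/
theorem cont_pos_of_compare (k : ℕ → ℝ) (hE : ∀ i, 0 ≤ E i) (m : ℕ) :
    ∀ a, (∀ i, a ≤ i → i ≤ a + m + 1 → 0 < k i) →
    (∀ i, a ≤ i → i < a + m → k i = A i * k (i + 1) - E i * k (i + 2)) →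
    k (a + m) ≤ Z (a + m) * k (a + m + 1) →
    0 < cont A Z E (a + 1) m ∧ k a * cont A Z E (a + 1) m ≤ cont A Z E a (m + 1) * k (a + 1) := by
  induction m with
  | zero => intro a _ _ h; simpa using h
  | succ m ih =>
    intro a hpos hrec hend
    obtain ⟨h1, h2⟩ := ih (a + 1) (fun i hi hi' => hpos i (by omega) (by omega))
      (fun i hi hi' => hrec i (by omega) (by omega))
      (by rw [show a + 1 + m = a + (m + 1) by ring]; exact hend)
    have k1 := hpos (a + 1) (by omega) (by omega)
    have k2 := hpos (a + 2) (by omega) (by omega)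
    rw [show a + 1 + 1 = a + 2 by ring] at h1 h2
    have h3 : 0 < cont A Z E (a + 1) (m + 1) := by
      by_contra hneg
      nlinarith [mul_pos k1 h1, mul_nonneg (sub_nonneg.2 (not_lt.1 hneg)) k2.le]
    refine ⟨h3, ?_⟩
    rw [cont_add_two, hrec a le_rfl (by omega)]
    nlinarith [mul_le_mul_of_nonneg_left h2 (hE a)]

end RealPivots

section Family

variable (α z e : ℕ → ℝ)

theorem continuous_cont (m : ℕ) : ∀ a, Continuous fun x : ℝ =>
    cont (fun i => x + α i) (fun i => x + z i) e a m := by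
  induction m using two_step_induction with
  | h0 => intro a; simpa using continuous_const
  | h1 => intro a; simp only [cont_one]; fun_prop
  | h m ih0 ih1 =>
    intro a
    simp only [cont_add_two]
    have := ih0 (a + 2)
    have := ih1 (a + 1)
    fun_prop

variable {α z e} (he : ∀ i, 0 ≤ e i) {r : ℝ} (hr : ∀ i, 1 + e i ≤ r + α i) (hr' : ∀ i, 1 ≤ r + z i)
include he hr hr'

theorem cont_pos_of_le {x : ℝ} (hx : r ≤ x) (a m : ℕ) :
    0 < cont (fun i => x + α i) (fun i => x + z i) e a m :=
  (cont_pos_of_one_le _ _ _ he (fun i => (hr i).trans (by linarith))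
    (fun i => (hr' i).trans (by linarith)) m a).1

/-- If a block is positive on a right half-line, so is the block without its first index. At the
largest root of the latter the recursion would make the former nonpositive. -/
theorem cont_tail_pos (m : ℕ) : ∀ a y,
    (∀ x, y ≤ x → 0 < cont (fun i => x + α i) (fun i => x + z i) e a (m + 1)) →
    ∀ x, y ≤ x → 0 < cont (fun i => x + α i) (fun i => x + z i) e (a + 1) m := by
  induction m with
  | zero => intros; simp
  | succ m ih =>
    intro a y hy x hx
    by_contra hneg
    set f := fun x : ℝ => cont (fun i => x + α i) (fun i => x + z i) e (a + 1) (m + 1) with hf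
    have fc : Continuous f := continuous_cont α z e (m + 1) (a + 1)
    -- the largest point of `s` is the largest root of `f`
    set s : Set ℝ := {t | f t ≤ 0} with hs
    have sb : BddAbove s := ⟨r, fun t ht => by
      by_contra hlt
      exact absurd (cont_pos_of_le he hr hr' (not_le.1 hlt).le (a + 1) (m + 1)) (not_lt.2 ht)⟩
    have sx : x ∈ s := not_lt.1 hneg
    have sc : IsClosed s := isClosed_le fc continuous_const
    have ht : sSup s ∈ s := sc.csSup_mem ⟨x, sx⟩ sb
    have hxt : x ≤ sSup s := le_csSup sb sx
    set t := sSup s with htdef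
    have hpos : ∀ u, t < u → 0 < f u := fun u hu => by
      by_contra hle
      exact absurd (le_csSup sb (show u ∈ s from not_lt.1 hle)) (not_le.2 hu)
    have lim : ∀ g : ℝ → ℝ, Continuous g → (∀ u, t < u → 0 < g u) → 0 ≤ g t := fun g hg h =>
      ge_of_tendsto (hg.continuousWithinAt (s := Set.Ioi t) (x := t))
        (Filter.eventually_of_mem self_mem_nhdsWithin fun u hu => (h u hu).le)
    have h1 : f t = 0 := le_antisymm ht (lim f fc hpos)
    have h2 : 0 ≤ cont (fun i => t + α i) (fun i => t + z i) e (a + 2) m :=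
      lim (fun u => cont (fun i => u + α i) (fun i => u + z i) e (a + 2) m)
        (continuous_cont α z e m (a + 2)) fun u hu =>
          ih (a + 1) u (fun v hv => hpos v (hu.trans_le hv)) u le_rfl
    have h3 := hy t (hx.trans hxt)
    rw [cont_add_two] at h3
    have h4 : cont (fun i => t + α i) (fun i => t + z i) e (a + 1) (m + 1) = 0 := h1
    rw [h4] at h3
    nlinarith [mul_nonneg (he a) h2]

/-- If a block has no root to the right of `y`, then all blocks with the same last index are
positive to the right of `y`. -/
theorem cont_pos_of_ne_zero {a m : ℕ} {y : ℝ}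
    (hne : ∀ x, y < x → cont (fun i => x + α i) (fun i => x + z i) e a m ≠ 0)
    {x : ℝ} (hx : y < x) (j : ℕ) (hj : j ≤ m) :
    0 < cont (fun i => x + α i) (fun i => x + z i) e (a + j) (m - j) := by
  have base : ∀ t, y < t → 0 < cont (fun i => t + α i) (fun i => t + z i) e a m := by
    intro t ht
    by_contra hle
    have hpos := cont_pos_of_le he hr hr' (le_max_right t r) a m
    obtain ⟨u, hu, hu0⟩ := intermediate_value_Icc (le_max_left t r)
      (continuous_cont α z e m a).continuousOn ⟨not_lt.1 hle, hpos.le⟩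
    exact hne u (ht.trans_le hu.1) hu0
  suffices ∀ t, x ≤ t → 0 < cont (fun i => t + α i) (fun i => t + z i) e (a + j) (m - j) from
    this x le_rfl
  induction j with
  | zero => intro t ht; exact base t (hx.trans_le ht)
  | succ j ih =>
    have := cont_tail_pos he hr hr' (m - (j + 1)) (a + j) x
      (by rw [show m - (j + 1) + 1 = m - j by omega]; exact ih (by omega))
    exact this

end Family

section Blocks

variable {R : Type*} [CommRing R]

/-- The determinant of `w + L` for the Laplacian `L` of the vehicles `a, …, a + m - 1`, pinned to
the vehicle `a - 1` and with the edge to the vehicle `a + m` removed. -/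
def cutBlock (ε : ℕ → R) (w : R) (a m : ℕ) : R :=
  cont (fun i => w + (1 + ε i)) (fun _ => w + 1) ε a m

/-- The determinant of the principal submatrix of `w + L` on the vehicles `a, …, a + m - 1`, that
is, with both neighbouring vehicles pinned. -/
def block (ε : ℕ → R) (w : R) (a m : ℕ) : R :=
  cont (fun i => w + (1 + ε i)) (fun i => w + (1 + ε i)) ε a m

theorem cutBlock_at_zero (ε : ℕ → R) (m : ℕ) : ∀ a, cutBlock ε 0 a m = 1 := by
  induction m using two_step_induction with
  | h0 => simp [cutBlock]
  | h1 => simp [cutBlock]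
  | h m ih0 ih1 =>
    intro a
    have h1 := ih1 (a + 1)
    have h0 := ih0 (a + 2)
    rw [cutBlock] at h0 h1 ⊢
    rw [cont_add_two, h0, h1]; ring

theorem block_succ (ε : ℕ → R) (w : R) (a m : ℕ) :
    block ε w a (m + 1) = cutBlock ε w a (m + 1) + ε (a + m) * block ε w a m := by
  rw [block, cutBlock, block, cont_succ_sub _ (fun _ => w + 1)]; ring

theorem cutBlock_last_eq (ε : ℕ → R) (w : R) (a m : ℕ) (h : ε (a + m) = 0) :
    cutBlock ε w a (m + 1) = block ε w a (m + 1) := by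
  rw [block_succ, h]; ring

theorem map_cutBlock {S : Type*} [CommRing S] (f : R →+* S) (ε : ℕ → R) (w : R) (a m : ℕ) :
    f (cutBlock ε w a m) = cutBlock (fun i => f (ε i)) (f w) a m := by
  simp [cutBlock, map_cont]

/-- The recursion for the blocks that end at `n`, without a special case at the end when the edge
behind `n` has zero weight. -/
theorem cont_tail_rec (A Z E : ℕ → R) {n : ℕ} (hE : E n = 0) (hA : A n = Z n) {i : ℕ}
    (hi : i ≤ n) : cont A Z E i (n + 1 - i) =
      A i * cont A Z E (i + 1) (n + 1 - (i + 1)) - E i * cont A Z E (i + 2) (n + 1 - (i + 2)) := by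
  rcases hi.eq_or_lt with rfl | hi
  · rw [show i + 1 - i = 1 by omega, show i + 1 - (i + 1) = 0 by omega]; simp [hE, hA]
  · rw [show n + 1 - i = (n + 1 - (i + 2)) + 2 by omega, cont_add_two,
      show n + 1 - (i + 2) + 1 = n + 1 - (i + 1) by omega]

end Blocks

section Spectrum

variable {ε : ℕ → ℝ} {lmin lmax : ℝ} {n : ℕ}

theorem cutBlock_pos_of_nonneg (hε : ∀ i, 0 ≤ ε i) {x : ℝ} (hx : 0 ≤ x) (a m : ℕ) :
    0 < cutBlock ε x a m :=
  cont_pos_of_le (r := 0) (z := fun _ => 1) hε (fun i => by simp) (fun i => by simp) hx a m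

theorem block_at_zero_pos (hε : ∀ i, 0 ≤ ε i) (a m : ℕ) : 0 < block ε 0 a m :=
  cont_pos_of_le (r := 0) hε (fun i => by simp) (fun i => by simp [hε i]) le_rfl a m

section Right

variable (hε : ∀ i, 0 ≤ ε i) (hn : ε n = 0)
  (hroot : ∀ x : ℝ, cutBlock ε x 1 n = 0 → x ∈ Set.Icc (-lmax) (-lmin))
include hε hroot

/-- The blocks that end at `n`, including the empty ones, are positive to the right of `-lmin`. -/
theorem tail_pos_right {x : ℝ} (hx : -lmin < x) {i : ℕ} (hi : 1 ≤ i) (hin : i ≤ n + 2) :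
    0 < cutBlock ε x i (n + 1 - i) := by
  rcases hin.eq_or_lt with rfl | hin
  · simp [cutBlock]
  · have := cont_pos_of_ne_zero (α := fun i => 1 + ε i) (z := fun _ => 1) (r := 0) hε
      (fun i => by simp) (fun i => by simp) (a := 1) (m := n) (y := -lmin)
      (fun t ht h0 => absurd (hroot t h0).2 (not_le.2 ht)) hx (i - 1) (by omega)
    rw [show 1 + (i - 1) = i by omega, show n - (i - 1) = n + 1 - i by omega] at this
    exact this

include hn

/-- On `(-lmin, 0]` all pivots of the elimination from the last row are at most `1`. -/
theorem tail_mono {x : ℝ} (hx : -lmin < x) (hx0 : x ≤ 0) : ∀ j ≤ n,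
    cutBlock ε x (n + 1 - j) j ≤ cutBlock ε x (n + 2 - j) (j - 1) := by
  intro j
  induction j with
  | zero => intro _; simp [cutBlock]
  | succ j ih =>
    intro hj
    have h1 := ih (by omega)
    have hr := cont_tail_rec (fun i => x + (1 + ε i)) (fun _ => x + 1) ε hn
      (by simp [hn]) (i := n - j) (by omega)
    have hp := tail_pos_right hε hroot hx (i := n + 1 - j) (by omega) (by omega)
    rw [show n + 1 - (n - j) = j + 1 by omega, show n + 1 - (n - j + 1) = j by omega,
      show n + 1 - (n - j + 2) = j - 1 by omega, show n - j + 1 = n + 1 - j by omega,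
      show n - j + 2 = n + 2 - j by omega] at hr
    rw [show n + 1 - (n + 1 - j) = j by omega] at hp
    rw [show n + 1 - (j + 1) = n - j by omega, show n + 2 - (j + 1) = n + 1 - j by omega,
      show j + 1 - 1 = j by omega]
    simp only [cutBlock] at *
    rw [hr]
    nlinarith [mul_le_mul_of_nonneg_left h1 (hε (n - j)), mul_nonneg (neg_nonneg.2 hx0) hp.le]

theorem block_pos_right {x : ℝ} (hx : -lmin < x) {a m : ℕ} (ha : 1 ≤ a) (hm : a + m ≤ n + 1) :
    0 < block ε x a m := by
  cases m with
  | zero => simp [block]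
  | succ m =>
    have key := cont_pos_of_compare (fun i => x + (1 + ε i)) (fun i => x + (1 + ε i)) ε
      (fun i => cutBlock ε x i (n + 1 - i)) hε m a
      (fun i hi hi' => tail_pos_right hε hroot hx (by omega) (by omega))
      (fun i hi hi' => cont_tail_rec _ _ ε hn (by simp [hn]) (by omega)) ?_
    · have h1 := tail_pos_right hε hroot hx (i := a) (by omega) (by omega)
      have h2 := tail_pos_right hε hroot hx (i := a + 1) (by omega) (by omega)
      exact pos_of_mul_pos_left ((mul_pos h1 key.1).trans_le key.2) h2.le
    · have hr := cont_tail_rec (fun i => x + (1 + ε i)) (fun _ => x + 1) ε hn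
        (by simp [hn]) (i := a + m) (by omega)
      have h2 := tail_pos_right hε hroot hx (i := a + m + 2) (by omega) (by omega)
      simp only [cutBlock] at *
      rw [hr]
      nlinarith [mul_nonneg (hε (a + m)) h2.le]

/-- Cutting an edge does not lower the smallest eigenvalue: the pivots of the whole platoon are at
most `1`, so that the last pivot `x + 1` of a cut block is at least as large as the corresponding
pivot of the whole platoon. -/
theorem cutBlock_pos_right {x : ℝ} (hx : -lmin < x) {a m : ℕ} (ha : 1 ≤ a) (hm : a + m ≤ n + 1) :
    0 < cutBlock ε x a m := by
  rcases le_total 0 x with h0 | h0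
  · exact cutBlock_pos_of_nonneg hε h0 a m
  cases m with
  | zero => simp [cutBlock]
  | succ m =>
    have key := cont_pos_of_compare (fun i => x + (1 + ε i)) (fun i => x + 1) ε
      (fun i => cutBlock ε x i (n + 1 - i)) hε m a
      (fun i hi hi' => tail_pos_right hε hroot hx (by omega) (by omega))
      (fun i hi hi' => cont_tail_rec _ _ ε hn (by simp [hn]) (by omega)) ?_
    · have h1 := tail_pos_right hε hroot hx (i := a) (by omega) (by omega)
      have h2 := tail_pos_right hε hroot hx (i := a + 1) (by omega) (by omega)
      exact pos_of_mul_pos_left ((mul_pos h1 key.1).trans_le key.2) h2.le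
    · have hr := cont_tail_rec (fun i => x + (1 + ε i)) (fun _ => x + 1) ε hn
        (by simp [hn]) (i := a + m) (by omega)
      have h2 := tail_mono hε hn hroot hx h0 (n - (a + m)) (by omega)
      rw [show n + 1 - (n - (a + m)) = a + m + 1 by omega,
        show n + 2 - (n - (a + m)) = a + m + 2 by omega,
        show n - (a + m) = n + 1 - (a + m + 1) by omega,
        show n + 1 - (a + m + 1) - 1 = n + 1 - (a + m + 2) by omega] at h2
      simp only [cutBlock] at *
      rw [hr]
      nlinarith [mul_le_mul_of_nonneg_left h2 (hε (a + m))]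

theorem lmin_le_one (h1n : 1 ≤ n) : lmin ≤ 1 := by
  by_contra h
  have := cutBlock_pos_right hε hn hroot (x := -1) (by linarith) (a := 1) (m := 1) le_rfl (by omega)
  simp [cutBlock] at this

/-- The steady-state gain of a leading block: the last pivot `cutBlock / block` increases with
slope at least `1` on `(-lmin, 0]`, where it is positive. -/
theorem lmin_mul_block_le_one {k : ℕ} (hk : k + 1 ≤ n) :
    lmin * block ε 0 1 k ≤ 1 := by
  have hB0 : ∀ m, 0 < block ε 0 1 m := block_at_zero_pos hε 1
  have key : ∀ x, -lmin < x → x ≤ 0 → -x * block ε 0 1 k ≤ 1 := by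
    intro x hx hx0
    have hB : ∀ m, m ≤ n → 0 < block ε x 1 m := fun m hm =>
      block_pos_right hε hn hroot hx le_rfl (by omega)
    have step : ∀ m, m + 1 ≤ n → block ε x 1 (m + 1) / block ε x 1 m ≤
        x + block ε 0 1 (m + 1) / block ε 0 1 m := by
      intro m
      induction m with
      | zero => intro _; simp [block]
      | succ m ih =>
        intro hm
        have h := ih (by omega)
        have e : ∀ y, 0 < block ε y 1 (m + 1) → 0 < block ε y 1 m →
            block ε y 1 (m + 1 + 1) / block ε y 1 (m + 1) = y + (1 + ε (1 + m + 1)) -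
              ε (1 + m) / (block ε y 1 (m + 1) / block ε y 1 m) := by
          intro y h1 h2
          have := cont_add_two' (fun i => y + (1 + ε i)) (fun i => y + (1 + ε i)) ε 1 m
          change block ε y 1 (m + 2) = _ * block ε y 1 (m + 1) - _ * block ε y 1 m at this
          rw [show m + 1 + 1 = m + 2 by ring, this]
          field_simp
        rw [e x (hB _ (by omega)) (hB _ (by omega)), e 0 (hB0 _) (hB0 _)]
        have hq : 0 < block ε x 1 (m + 1) / block ε x 1 m :=
          div_pos (hB _ (by omega)) (hB _ (by omega))
        have := div_le_div_of_nonneg_left (hε (1 + m)) hq (h.trans (add_le_of_nonpos_left hx0))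
        linarith
    have hc : 0 < cutBlock ε x 1 (k + 1) := cutBlock_pos_right hε hn hroot hx le_rfl (by omega)
    have hs := step k hk
    rw [block_succ, block_succ, cutBlock_at_zero, add_div, add_div, mul_div_cancel_right₀ _
      (hB0 k).ne', mul_div_cancel_right₀ _ (hB k (by omega)).ne'] at hs
    have h1 : 0 < cutBlock ε x 1 (k + 1) / block ε x 1 k := div_pos hc (hB k (by omega))
    have h2 : -x < 1 / block ε 0 1 k := by linarith
    exact ((lt_div_iff₀ (hB0 k)).1 h2).le
  by_contra h
  have hb := hB0 k
  obtain ⟨t, ht1, ht2⟩ : ∃ t, 1 / block ε 0 1 k < t ∧ t < lmin :=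
    exists_between ((div_lt_iff₀ hb).2 (not_le.1 h))
  have ht0 : 0 < t := lt_trans (by positivity) ht1
  have := key (-t) (by linarith) (by linarith)
  rw [neg_neg] at this
  exact absurd ((div_lt_iff₀ hb).1 ht1) (not_lt.2 this)

end Right

section Left

variable (hε : ∀ i, 0 ≤ ε i) (hbdd : ∃ b, ∀ i, ε i ≤ b) (hn : ε n = 0)
  (hroot : ∀ x : ℝ, cutBlock ε x 1 n = 0 → x ∈ Set.Icc (-lmax) (-lmin))
include hε hbdd hroot

/-- With the sign `(-1) ^ m`, which makes them determinants of `x - L`, the blocks that end at `n`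
are positive for `x` to the right of `lmax`. -/
theorem tail_pos_left {x : ℝ} (hx : lmax < x) {i : ℕ} (hi : 1 ≤ i) (hin : i ≤ n + 2) :
    0 < cont (fun i => x + -(1 + ε i)) (fun _ => x + -1) ε i (n + 1 - i) := by
  rcases hin.eq_or_lt with rfl | hin
  · simp
  · obtain ⟨b, hb⟩ := hbdd
    have := cont_pos_of_ne_zero (α := fun i => -(1 + ε i)) (z := fun _ => -1) (r := 2 + 2 * b) hε
      (fun i => by linarith [hb i]) (fun i => by linarith [hb i, hε i]) (a := 1) (m := n)
      (y := lmax) (fun t ht h0 => ?_) hx (i - 1) (by omega)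
    · rw [show 1 + (i - 1) = i by omega, show n - (i - 1) = n + 1 - i by omega] at this
      exact this
    · have h := hroot (-t) (by
        have := cont_neg (fun i => t + -(1 + ε i)) (fun _ => t + -1) ε n 1
        rw [h0, mul_zero] at this
        rw [← this, cutBlock]
        congr 1 <;> ext <;> ring)
      linarith [h.1]

include hn

/-- The diagonal entries of the Laplacian are at most its largest eigenvalue. -/
theorem one_add_le_lmax {i : ℕ} (hi : 1 ≤ i) (hin : i ≤ n) : 1 + ε i ≤ lmax := by
  by_contra h
  obtain ⟨x, hx1, hx2⟩ := exists_between (not_le.1 h)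
  have hr := cont_tail_rec (fun i => x + -(1 + ε i)) (fun _ => x + -1) ε hn (by simp [hn]) hin
  have h0 := tail_pos_left hε hbdd hroot hx1 hi (by omega)
  have h1 := tail_pos_left hε hbdd hroot hx1 (i := i + 1) (by omega) (by omega)
  have h2 := tail_pos_left hε hbdd hroot hx1 (i := i + 2) (by omega) (by omega)
  rw [hr] at h0
  nlinarith [mul_nonneg (hε i) h2.le]

theorem cutBlock_ne_zero_left {x : ℝ} (hx : lmax < x) {a m : ℕ} (ha : 1 ≤ a)
    (hm : a + m ≤ n + 1) : cutBlock ε (-x) a m ≠ 0 := by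
  cases m with
  | zero => simp [cutBlock]
  | succ m =>
    have key := cont_pos_of_compare (fun i => x + -(1 + ε i)) (fun i => x + -1) ε
      (fun i => cont (fun i => x + -(1 + ε i)) (fun _ => x + -1) ε i (n + 1 - i)) hε m a
      (fun i hi hi' => tail_pos_left hε hbdd hroot hx (by omega) (by omega))
      (fun i hi hi' => cont_tail_rec _ _ ε hn (by simp [hn]) (by omega)) ?_
    · have h1 := tail_pos_left hε hbdd hroot hx (i := a) (by omega) (by omega)
      have h2 := tail_pos_left hε hbdd hroot hx (i := a + 1) (by omega) (by omega)
      have h3 := pos_of_mul_pos_left ((mul_pos h1 key.1).trans_le key.2) h2.le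
      have h4 := cont_neg (fun i => x + -(1 + ε i)) (fun _ => x + -1) ε (m + 1) a
      have h5 : cutBlock ε (-x) a (m + 1) = (-1) ^ (m + 1) *
          cont (fun i => x + -(1 + ε i)) (fun _ => x + -1) ε a (m + 1) := by
        rw [← h4, cutBlock]
        congr 1 <;> ext <;> ring
      rw [h5]
      exact mul_ne_zero (by simp) h3.ne'
    · have hr := cont_tail_rec (fun i => x + -(1 + ε i)) (fun _ => x + -1) ε hn
        (by simp [hn]) (i := a + m) (by omega)
      have h1 := tail_pos_left hε hbdd hroot hx (i := a + m + 1) (by omega) (by omega)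
      have h2 := tail_pos_left hε hbdd hroot hx (i := a + m + 2) (by omega) (by omega)
      rw [hr]
      nlinarith [mul_nonneg (hε (a + m)) h2.le, mul_nonneg (hε (a + m)) h1.le]

/-- The cut blocks inherit the spectral bounds of the whole platoon. -/
theorem cutBlock_root_mem {a m : ℕ} (ha : 1 ≤ a) (hm : a + m ≤ n + 1) {x : ℝ}
    (hx : cutBlock ε x a m = 0) : x ∈ Set.Icc (-lmax) (-lmin) := by
  constructor
  · by_contra h
    exact cutBlock_ne_zero_left hε hbdd hn hroot (x := -x) (by linarith) ha hm (by simpa using hx)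
  · by_contra h
    exact (cutBlock_pos_right hε hn hroot (not_le.1 h) ha hm).ne' hx

end Left

end Spectrum


/-! ### Estimates for the blocks at a fixed frequency -/

/-- A set of complex numbers of modulus at least `δ` that contains the last diagonal entries of
`w + L` and of its cut and uncut blocks and is preserved by the elimination steps; hence it contains
all their pivots. -/
structure IsPivotSet (ε : ℕ → ℝ) (w : ℂ) (δ : ℝ) (S : Set ℂ) : Prop where
  pos : 0 < δ
  le_norm : ∀ p ∈ S, δ ≤ ‖p‖
  diag_mem : ∀ i, w + (1 + (ε i : ℂ)) ∈ S
  last_mem : w + 1 ∈ S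
  diag_sub_mem : ∀ i j, ∀ p ∈ S, w + (1 + (ε j : ℂ)) - ε i / p ∈ S
  last_sub_mem : ∀ i, ∀ p ∈ S, w + 1 - ε i / p ∈ S

/-- For nonreal `w` the imaginary parts of all pivots have the sign of `w.im`, and are at least
as large in modulus. -/
theorem isPivotSet_of_im_ne_zero {ε : ℕ → ℝ} (hε : ∀ i, 0 ≤ ε i) {w : ℂ} (hw : w.im ≠ 0) :
    IsPivotSet ε w |w.im| {p | w.im ^ 2 ≤ w.im * p.im} := by
  have key : ∀ e e' : ℝ, 0 ≤ e → ∀ p : ℂ, w.im ^ 2 ≤ w.im * p.im →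
      w.im ^ 2 ≤ w.im * (w + (1 + (e' : ℂ)) - e / p).im := by
    intro e e' he p hp
    have h1 : (w + (1 + (e' : ℂ)) - e / p).im = w.im + e * p.im / Complex.normSq p := by
      simp [Complex.div_im]
    have h2 : w.im * (w.im + e * p.im / Complex.normSq p) =
        w.im ^ 2 + e * (w.im * p.im) / Complex.normSq p := by ring
    rw [h1, h2]
    have : 0 ≤ e * (w.im * p.im) / Complex.normSq p :=
      div_nonneg (mul_nonneg he ((sq_nonneg _).trans hp)) (Complex.normSq_nonneg p)
    linarith
  refine ⟨abs_pos.2 hw, fun p hp => ?_, fun i => ?_, ?_, fun i j p hp => key _ _ (hε i) p hp,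
    fun i p hp => by simpa using key (ε i) 0 (hε i) p hp⟩
  · have h1 : |w.im| * |w.im| ≤ |w.im| * |p.im| := by
      rw [← abs_mul, ← abs_mul, abs_mul_self]
      exact le_trans (by rw [← sq]; exact hp) (le_abs_self _)
    exact (le_of_mul_le_mul_left h1 (abs_pos.2 hw)).trans (Complex.abs_im_le_norm p)
  · simp [sq]
  · simp [sq]

/-- Without edges to the vehicles behind, all pivots are equal to `w + 1`, for real `w` too. -/
theorem isPivotSet_of_eq_zero {ε : ℕ → ℝ} (hε : ∀ i, ε i = 0) {w : ℂ} (hw : w + 1 ≠ 0) :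
    IsPivotSet ε w ‖w + 1‖ {w + 1} where
  pos := norm_pos_iff.2 hw
  le_norm := by simp
  diag_mem := by simp [hε]
  last_mem := by simp
  diag_sub_mem := by simp [hε]
  last_sub_mem := by simp [hε]

namespace IsPivotSet

variable {ε : ℕ → ℝ} {w : ℂ} {δ : ℝ} {S : Set ℂ} (h : IsPivotSet ε w δ S)
include h

theorem zero_notMem : (0 : ℂ) ∉ S := fun h0 => by
  have := h.le_norm 0 h0
  rw [norm_zero] at this
  exact absurd h.pos (not_lt.2 this)

theorem cutBlock_ne_zero (a m : ℕ) : cutBlock (fun i => (ε i : ℂ)) w a m ≠ 0 :=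
  (trailing_pivot_mem (fun i => w + (1 + (ε i : ℂ))) (fun _ => w + 1) (fun i => (ε i : ℂ)) S
    h.zero_notMem (fun _ => h.last_mem) (fun i p hp => h.diag_sub_mem i i p hp) m a).1

theorem norm_tail_le (a m : ℕ) : δ * ‖cutBlock (fun i => (ε i : ℂ)) w (a + 1) m‖ ≤
    ‖cutBlock (fun i => (ε i : ℂ)) w a (m + 1)‖ := by
  have := h.le_norm _ (trailing_pivot_mem (fun i => w + (1 + (ε i : ℂ))) (fun _ => w + 1)
    (fun i => (ε i : ℂ)) S h.zero_notMem (fun _ => h.last_mem)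
    (fun i p hp => h.diag_sub_mem i i p hp) m a).2
  rw [norm_div] at this
  exact (le_div_iff₀ (norm_pos_iff.2 (h.cutBlock_ne_zero (a + 1) m))).1 this

theorem norm_block_le (a m : ℕ) :
    δ * ‖block (fun i => (ε i : ℂ)) w a m‖ ≤ ‖block (fun i => (ε i : ℂ)) w a (m + 1)‖ ∧
    δ * ‖block (fun i => (ε i : ℂ)) w a m‖ ≤ ‖cutBlock (fun i => (ε i : ℂ)) w a (m + 1)‖ := by
  obtain ⟨h0, h1, h2⟩ := leading_pivot_mem (fun i => w + (1 + (ε i : ℂ))) (fun _ => w + 1)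
    (fun i => (ε i : ℂ)) S h.zero_notMem (fun i => h.diag_mem i) (fun _ => h.last_mem)
    (fun i p hp => h.diag_sub_mem i (i + 1) p hp) (fun i p hp => h.last_sub_mem i p hp) a m
  have h1 := h.le_norm _ h1
  have h2 := h.le_norm _ h2
  rw [norm_div, le_div_iff₀ (norm_pos_iff.2 h0)] at h1 h2
  exact ⟨h1, h2⟩

variable {b : ℝ} (hε : ∀ i, 0 ≤ ε i) (hb : ∀ i, ε i ≤ b)
include hε hb

/-- Removing the edge behind a leading block of `m` vehicles changes the determinant by at most
a constant factor. -/
theorem norm_cutBlock_add_le (a m l : ℕ) : ‖cutBlock (fun i => (ε i : ℂ)) w a (m + l)‖ ≤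
    (1 + b / δ * (1 + 1 / δ)) * (‖cutBlock (fun i => (ε i : ℂ)) w a m‖ *
      ‖cutBlock (fun i => (ε i : ℂ)) w (a + m) l‖) := by
  have hb0 : 0 ≤ b := (hε 0).trans (hb 0)
  have hδ := h.pos
  have hC : 1 ≤ 1 + b / δ * (1 + 1 / δ) := le_add_of_nonneg_right (by positivity)
  rcases m with _ | m
  · simpa [cutBlock] using le_mul_of_one_le_left (norm_nonneg _) hC
  rcases l with _ | l
  · simpa [cutBlock] using le_mul_of_one_le_left (norm_nonneg _) hC
  have e : cutBlock (fun i => (ε i : ℂ)) w a (m + 1 + (l + 1)) =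
      cutBlock (fun i => (ε i : ℂ)) w a (m + 1) *
        cutBlock (fun i => (ε i : ℂ)) w (a + (m + 1)) (l + 1) +
      ε (a + m) * block (fun i => (ε i : ℂ)) w a m *
        (cutBlock (fun i => (ε i : ℂ)) w (a + (m + 1)) (l + 1) -
          cutBlock (fun i => (ε i : ℂ)) w (a + (m + 1) + 1) l) := by
    have e1 := cont_split (fun i => w + (1 + (ε i : ℂ))) (fun _ => w + 1) (fun i => (ε i : ℂ)) l m a
    have e2 := block_succ (fun i => (ε i : ℂ)) w a m
    rw [block] at e2
    rw [e2] at e1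
    simp only [cutBlock, block] at e1 ⊢
    rw [e1, show a + (m + 1) + 1 = a + m + 2 by ring, show a + (m + 1) = a + m + 1 by ring]
    ring
  have h1 := (h.norm_block_le a m).2
  have h2 := h.norm_tail_le (a + (m + 1)) l
  rw [e]
  set x := ‖cutBlock (fun i => (ε i : ℂ)) w a (m + 1)‖ with hx
  set y := ‖cutBlock (fun i => (ε i : ℂ)) w (a + (m + 1)) (l + 1)‖ with hy
  rw [mul_comm, ← le_div_iff₀ hδ] at h1 h2
  calc _ ≤ x * y + b * (x / δ) * (y + y / δ) := by
        refine (norm_add_le _ _).trans ?_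
        rw [norm_mul, norm_mul, norm_mul, Complex.norm_real, Real.norm_of_nonneg (hε _)]
        refine add_le_add le_rfl (mul_le_mul (mul_le_mul (hb _) h1 (norm_nonneg _) hb0)
          ((norm_sub_le _ _).trans (add_le_add le_rfl h2)) (norm_nonneg _) (by positivity))
    _ = _ := by field_simp

/-- Cutting the edge behind a block increases its determinant by at most a constant factor. -/
theorem norm_cutBlock_le_block (a m : ℕ) : ‖cutBlock (fun i => (ε i : ℂ)) w a m‖ ≤
    (1 + b / δ) * ‖block (fun i => (ε i : ℂ)) w a m‖ := by
  have hb0 : 0 ≤ b := (hε 0).trans (hb 0)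
  have hδ := h.pos
  rcases m with _ | m
  · simpa [cutBlock, block] using div_nonneg hb0 hδ.le
  have h1 := (h.norm_block_le a m).1
  rw [mul_comm, ← le_div_iff₀ hδ] at h1
  have e : cutBlock (fun i => (ε i : ℂ)) w a (m + 1) = block (fun i => (ε i : ℂ)) w a (m + 1) -
      ε (a + m) * block (fun i => (ε i : ℂ)) w a m := by rw [block_succ]; ring
  set x := ‖block (fun i => (ε i : ℂ)) w a (m + 1)‖ with hx
  rw [e]
  calc _ ≤ x + b * (x / δ) := by
        refine (norm_sub_le _ _).trans ?_
        rw [norm_mul, Complex.norm_real, Real.norm_of_nonneg (hε _)]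
        exact add_le_add le_rfl (mul_le_mul (hb _) h1 (norm_nonneg _) hb0)
    _ = _ := by ring

end IsPivotSet

section Product

open Polynomial in
theorem cutBlock_X_monic (ε : ℕ → ℂ) (m : ℕ) : ∀ a,
    (cutBlock (fun i => C (ε i)) X a m).Monic ∧
      (cutBlock (fun i => C (ε i)) X a m).natDegree = m := by
  induction m using two_step_induction with
  | h0 => simp [cutBlock]
  | h1 =>
    intro a
    have e : cutBlock (fun i => C (ε i)) X a 1 = X + C 1 := by simp [cutBlock]
    rw [e]
    exact ⟨monic_X_add_C 1, natDegree_X_add_C 1⟩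
  | h m ih0 ih1 =>
    intro a
    obtain ⟨m1, d1⟩ := ih1 (a + 1)
    obtain ⟨m0, d0⟩ := ih0 (a + 2)
    have e : cutBlock (fun i => C (ε i)) X a (m + 2) =
        (X + C (1 + ε a)) * cutBlock (fun i => C (ε i)) X (a + 1) (m + 1) -
          C (ε a) * cutBlock (fun i => C (ε i)) X (a + 2) m := by
      rw [cutBlock, cont_add_two]; simp [cutBlock]
    have m2 : ((X + C (1 + ε a)) * cutBlock (fun i => C (ε i)) X (a + 1) (m + 1)).Monic :=
      (monic_X_add_C _).mul m1
    have d2 : ((X + C (1 + ε a)) * cutBlock (fun i => C (ε i)) X (a + 1) (m + 1)).natDegree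
        = m + 2 := by
      rw [(monic_X_add_C _).natDegree_mul m1, natDegree_X_add_C, d1]; ring
    have d3 : (C (ε a) * cutBlock (fun i => C (ε i)) X (a + 2) m).natDegree < m + 2 :=
      (natDegree_C_mul_le _ _).trans_lt (by omega)
    rw [e]
    have d4 : (C (ε a) * cutBlock (fun i => C (ε i)) X (a + 2) m).degree <
        ((X + C (1 + ε a)) * cutBlock (fun i => C (ε i)) X (a + 1) (m + 1)).degree :=
      degree_lt_degree (by rw [d2]; exact d3)
    exact ⟨m2.sub_of_left d4, by rw [natDegree_sub_eq_left_of_natDegree_lt (by rwa [d2]), d2]⟩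

theorem eval_cutBlock_X (ε : ℕ → ℂ) (w : ℂ) (a m : ℕ) :
    (cutBlock (fun i => Polynomial.C (ε i)) Polynomial.X a m).eval w = cutBlock ε w a m := by
  have := map_cutBlock (Polynomial.evalRingHom w) (fun i => Polynomial.C (ε i)) Polynomial.X a m
  simpa using this

/-- All roots of a cut block are real, since its pivots at nonreal points do not vanish. As its
value at `0` is `1`, it is the product of the factors `(w + l) / l` over its eigenvalues `l`. -/
theorem pow_mul_norm_cutBlock_le_one {ε : ℕ → ℝ} (hε : ∀ i, 0 ≤ ε i) {lmin lmax : ℝ} {a m : ℕ}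
    (hroot : ∀ x : ℝ, cutBlock ε x a m = 0 → x ∈ Set.Icc (-lmax) (-lmin)) {w : ℂ} {ζ : ℝ}
    (hζ0 : 0 ≤ ζ) (hζ : ∀ l ∈ Set.Icc lmin lmax, ζ * ‖w + (l : ℂ)‖ ≤ l) :
    ζ ^ m * ‖cutBlock (fun i => (ε i : ℂ)) w a m‖ ≤ 1 := by
  obtain ⟨hm, hd⟩ := cutBlock_X_monic (fun i => (ε i : ℂ)) m a
  set q := cutBlock (fun i => Polynomial.C (ε i : ℂ)) Polynomial.X a m with hq
  have hs : q.Splits := IsAlgClosed.splits q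
  have hev : ∀ z : ℂ, (q.roots.map fun r => z - r).prod = cutBlock (fun i => (ε i : ℂ)) z a m := by
    intro z
    rw [← eval_cutBlock_X, ← hq]
    conv_rhs => rw [hs.eq_prod_roots_of_monic hm]
    rw [Polynomial.eval_multiset_prod, Multiset.map_map]
    simp
  have hr : ∀ r ∈ q.roots, ζ * ‖w - r‖ ≤ ‖0 - r‖ := by
    intro r hr
    have h0 : cutBlock (fun i => (ε i : ℂ)) r a m = 0 := by
      rw [← eval_cutBlock_X]; exact (Polynomial.mem_roots'.1 hr).2
    have him : r.im = 0 := by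
      by_contra him
      exact (isPivotSet_of_im_ne_zero hε him).cutBlock_ne_zero a m h0
    obtain ⟨x, rfl⟩ : ∃ x : ℝ, (x : ℂ) = r := ⟨r.re, by apply Complex.ext <;> simp [him]⟩
    have hx := hroot x (by
      have := map_cutBlock Complex.ofRealHom ε x a m
      simp only [Complex.ofRealHom_eq_coe] at this
      exact_mod_cast this.trans h0)
    have := hζ (-x) ⟨by linarith [hx.2], by linarith [hx.1]⟩
    rw [zero_sub, norm_neg, Complex.norm_real]
    refine le_trans ?_ (this.trans (neg_le_abs x))
    simp [sub_eq_add_neg]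
  have gen : ∀ s : Multiset ℂ, (∀ r ∈ s, ζ * ‖w - r‖ ≤ ‖0 - r‖) →
      ζ ^ s.card * ‖(s.map fun r => w - r).prod‖ ≤ ‖(s.map fun r => 0 - r).prod‖ := by
    intro s
    induction s using Multiset.induction with
    | empty => simp
    | cons r s ih =>
      intro h
      have h1 := h r (Multiset.mem_cons_self r s)
      have h2 := ih fun t ht => h t (Multiset.mem_cons_of_mem ht)
      rw [Multiset.card_cons, Multiset.map_cons, Multiset.map_cons, Multiset.prod_cons,
        Multiset.prod_cons, norm_mul, norm_mul]
      calc _ = ζ * ‖w - r‖ * (ζ ^ s.card * ‖(s.map fun r => w - r).prod‖) := by ring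
        _ ≤ _ := mul_le_mul h1 h2 (by positivity) (norm_nonneg _)
  have := gen q.roots hr
  rwa [hev, hev, cutBlock_at_zero, norm_one, ← hs.natDegree_eq_card_roots, hd] at this

end Product

/-- The lower bound for the transfer function, up to the factor `∏ ε i`, along a path of `m`
vehicles with `k` vehicles in front of it and `l` behind it. -/
theorem pow_mul_block_le {ε : ℕ → ℝ} (hε : ∀ i, 0 ≤ ε i) {lmin lmax : ℝ} (hmin : 0 < lmin)
    {k m l : ℕ} (hm : 1 ≤ m) (hn : ε (k + m + l) = 0) (hb : ∀ i, ε i ≤ lmax)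
    (hroot : ∀ x : ℝ, cutBlock ε x 1 (k + m + l) = 0 → x ∈ Set.Icc (-lmax) (-lmin))
    {w : ℂ} {ζ δ : ℝ} {S : Set ℂ} (hS : IsPivotSet ε w δ S)
    (hζ0 : 0 ≤ ζ) (hζ : ∀ l ∈ Set.Icc lmin lmax, ζ * ‖w + (l : ℂ)‖ ≤ l) :
    lmin * (ζ ^ m * block ε 0 1 k) * ‖cutBlock (fun i => (ε i : ℂ)) w 1 (k + m + l)‖ ≤
      (1 + lmax / δ * (1 + 1 / δ)) ^ 2 * (1 + lmax / δ) *
        (‖block (fun i => (ε i : ℂ)) w 1 k‖ *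
          ‖cutBlock (fun i => (ε i : ℂ)) w (1 + k + m) l‖) := by
  have hδ := hS.pos
  have hb0 : 0 ≤ lmax := (hε 0).trans (hb 0)
  set C := 1 + lmax / δ * (1 + 1 / δ) with hC
  have hC0 : 0 ≤ C := by positivity
  have h1 := hS.norm_cutBlock_add_le hε hb 1 (k + m) l
  have h2 := hS.norm_cutBlock_add_le hε hb 1 k m
  have h3 := hS.norm_cutBlock_le_block hε hb 1 k
  have h4 := lmin_mul_block_le_one hε hn hroot (k := k) (by omega)
  have h5 := pow_mul_norm_cutBlock_le_one hε (a := 1 + k) (m := m) (fun x hx =>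
    cutBlock_root_mem hε ⟨lmax, hb⟩ hn hroot (by omega) (by omega) hx) hζ0 hζ
  rw [← hC] at h1 h2
  rw [show 1 + (k + m) = 1 + k + m by ring] at h1
  set x := ‖cutBlock (fun i => (ε i : ℂ)) w 1 k‖ with hx
  set y := ‖cutBlock (fun i => (ε i : ℂ)) w (1 + k) m‖ with hy
  set z := ‖cutBlock (fun i => (ε i : ℂ)) w (1 + k + m) l‖ with hz
  set u := ‖block (fun i => (ε i : ℂ)) w 1 k‖ with hu
  have hB := (block_at_zero_pos hε 1 k).le
  calc _ ≤ lmin * (ζ ^ m * block ε 0 1 k) * (C * (C * ((1 + lmax / δ) * u * y) * z)) := by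
        refine mul_le_mul_of_nonneg_left ?_ (by positivity)
        refine h1.trans (mul_le_mul_of_nonneg_left ?_ hC0)
        refine mul_le_mul_of_nonneg_right ?_ (norm_nonneg _)
        exact h2.trans (mul_le_mul_of_nonneg_left
          (mul_le_mul_of_nonneg_right h3 (norm_nonneg _)) hC0)
    _ = (lmin * block ε 0 1 k) * (ζ ^ m * y) * (C ^ 2 * (1 + lmax / δ) * (u * z)) := by ring
    _ ≤ 1 * (C ^ 2 * (1 + lmax / δ) * (u * z)) := by
        refine mul_le_mul_of_nonneg_right ?_ (by positivity)
        exact mul_le_one₀ h4 (by positivity) h5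
    _ = _ := one_mul _


/-! ### The transfer functions of the platoon -/

section Matrix

/-- The constants of bidirectionality as a sequence, with `0` for the leader and for the trailing
vehicle, whose constants do not enter the Laplacian, and beyond. -/
noncomputable def innerWeight {N : ℕ} (ε : Fin N → ℝ) (i : ℕ) : ℝ :=
  if h : i ≠ 0 ∧ i + 1 < N then ε ⟨i, by omega⟩ else 0

variable {N : ℕ} (ε : Fin N → ℝ)

theorem innerWeight_zero : innerWeight ε 0 = 0 := by simp [innerWeight]

theorem innerWeight_of_le {i : ℕ} (h : N ≤ i + 1) : innerWeight ε i = 0 := by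
  rw [innerWeight, dif_neg]; omega

theorem innerWeight_nonneg (hε : ∀ i, 0 ≤ ε i) (i : ℕ) : 0 ≤ innerWeight ε i := by
  rw [innerWeight]; split_ifs; exacts [hε _, le_rfl]

theorem innerWeight_bddAbove : ∃ b, ∀ i, innerWeight ε i ≤ b := by
  refine ⟨∑ i, |ε i|, fun i => ?_⟩
  rw [innerWeight]
  split_ifs with h
  · exact (le_abs_self _).trans
      (Finset.single_le_sum (f := fun i => |ε i|) (fun _ _ => abs_nonneg _) (Finset.mem_univ _))
  · positivity

theorem sum_fin_ite_eq {K : Type*} [AddCommMonoid K] (k : ℕ) (c : K) :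
    ∑ j : Fin N, (if (j : ℕ) = k then c else 0) = if k < N then c else 0 := by
  rw [Fin.sum_univ_eq_sum_range (fun j => if j = k then c else 0) N, Finset.sum_ite_eq']
  simp

theorem sum_laplacian_mul {K : Type*} [CommRing K] (f : ℝ →+* K) (x : ℕ → K) (i : Fin N) :
    ∑ j, f (laplacian N ε i j) * x j = if (i : ℕ) = 0 then 0 else
      (1 + f (innerWeight ε i)) * x i - x (i - 1) - f (innerWeight ε i) * x (i + 1) := by
  by_cases h0 : (i : ℕ) = 0
  · simp [laplacian, h0]
  have hi := i.2
  have hw : ∀ j : Fin N, f (laplacian N ε i j) * x j =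
      (if (j : ℕ) = i - 1 then -x (i - 1) else 0) +
      (if (j : ℕ) = i then (1 + f (innerWeight ε i)) * x i else 0) +
      (if (j : ℕ) = i + 1 then -(f (innerWeight ε i) * x (i + 1)) else 0) := by
    intro j
    have hj := j.2
    have e1 : (i : ℕ) + 1 < N → innerWeight ε i = ε i := fun h => by
      rw [innerWeight, dif_pos ⟨h0, h⟩]
    have e2 : (i : ℕ) + 1 = N → innerWeight ε i = 0 := fun h => innerWeight_of_le ε h.ge
    simp only [laplacian, Matrix.of_apply, if_neg h0, Fin.ext_iff]
    by_cases a1 : (j : ℕ) + 1 = i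
    · have a2 : (j : ℕ) = i - 1 := by omega
      have a3 : ¬ (j : ℕ) = i := by omega
      have a4 : ¬ (j : ℕ) = i + 1 := by omega
      simp only [if_pos a1, if_neg a3, if_neg a4, ← a2]
      simp
    have b1 : ¬ (j : ℕ) = i - 1 := by omega
    by_cases a2 : (j : ℕ) = i
    · have a3 : ¬ (j : ℕ) = i + 1 := by omega
      simp only [if_neg a1, if_neg b1, if_pos a2, if_neg a3]
      split_ifs with hN
      · simp [e2 hN, a2]
      · simp [e1 (by omega), a2]
    by_cases a3 : (j : ℕ) = i + 1
    · simp only [if_neg a1, if_neg b1, if_neg a2, if_pos a3]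
      rw [e1 (by omega), a3]; simp
    · simp only [if_neg a1, if_neg b1, if_neg a2, if_neg a3]; simp
  rw [Finset.sum_congr rfl fun j _ => hw j, Finset.sum_add_distrib, Finset.sum_add_distrib,
    sum_fin_ite_eq, sum_fin_ite_eq, sum_fin_ite_eq, if_pos (by omega), if_pos (by omega),
    if_neg h0]
  split_ifs with h
  · ring
  · rw [innerWeight_of_le ε (by omega)]; simp; ring

/-- The roots of the determinant of `w + L` without the leader are, up to sign, eigenvalues of the
Laplacian; the trailing determinants at `-l` form an eigenvector. -/
theorem hasEigenvalue_of_cutBlock_eq_zero (hN : 2 ≤ N) {l : ℝ}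
    (hl : cutBlock (innerWeight ε) (-l) 1 (N - 1) = 0) :
    Module.End.HasEigenvalue (Matrix.toLin' (laplacian N ε)) l ∧ l ≠ 0 := by
  have hl0 : l ≠ 0 := by
    rintro rfl
    rw [neg_zero, cutBlock_at_zero] at hl
    exact one_ne_zero hl
  refine ⟨?_, hl0⟩
  set x : ℕ → ℝ := fun j => cutBlock (innerWeight ε) (-l) (j + 1) (N - 1 - j) with hx
  refine Module.End.hasEigenvalue_of_hasEigenvector (x := fun j : Fin N => x j) ⟨?_, ?_⟩
  · rw [Module.End.mem_eigenspace_iff]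
    ext i
    have hs := sum_laplacian_mul ε (RingHom.id ℝ) x i
    simp only [RingHom.id_apply] at hs
    simp only [Matrix.toLin'_apply, Matrix.mulVec, dotProduct, Pi.smul_apply, smul_eq_mul]
    rw [hs]
    split_ifs with h0
    · simp [hx, h0, hl]
    · have hr := cont_tail_rec (fun i => -l + (1 + innerWeight ε i)) (fun _ => -l + 1)
        (innerWeight ε) (n := N - 1) (innerWeight_of_le ε (by omega))
        (by simp [innerWeight_of_le ε (show N ≤ N - 1 + 1 by omega)]) (i := i) (by omega)
      simp only [hx, cutBlock]
      rw [show (i : ℕ) - 1 + 1 = i by omega, show N - 1 - ((i : ℕ) - 1) = N - 1 + 1 - i by omega,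
        hr, show N - 1 + 1 - ((i : ℕ) + 1) = N - 1 - i by omega,
        show N - 1 + 1 - ((i : ℕ) + 2) = N - 1 - (i + 1) by omega]
      ring
  · intro h0
    have := congrFun h0 ⟨N - 1, by omega⟩
    simp [hx, cutBlock] at this

end Matrix

section Inverse

variable {K : Type*} [Field K] (A E : ℕ → K)

/-- The entries of the adjugate of a tridiagonal matrix of size `N` with subdiagonal `-1`. -/
def triAdjugate (N o c : ℕ) : K :=
  (∏ i ∈ Finset.Ico o c, E i) * cont A A E 0 (min o c) *
    cont A A E (max o c + 1) (N - (max o c + 1))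

/-- The columns of `triAdjugate` solve the tridiagonal system with determinant times unit vector on
the right. As `E (N - 1) = 0`, the entry of index `N` does not matter in the last row. -/
theorem triAdjugate_spec {N i c : ℕ} (hE : E (N - 1) = 0) (hi : i < N) (hc : c < N) :
    A i * triAdjugate A E N i c - (if i = 0 then 0 else triAdjugate A E N (i - 1) c) -
      E i * triAdjugate A E N (i + 1) c = if i = c then cont A A E 0 N else 0 := by
  have hN : N - 1 + 1 = N := by omega
  have hr := fun (j : ℕ) (hj : j ≤ N - 1) => cont_tail_rec A A E hE rfl hj
  simp only [hN] at hr
  -- expansion along the last row, for all lengths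
  have hl : ∀ j, cont A A E 0 (j + 1) =
      A j * cont A A E 0 j - if j = 0 then 0 else E (j - 1) * cont A A E 0 (j - 1) := by
    intro j
    rcases j with _ | j
    · simp
    · rw [cont_add_two']; simp
  rcases lt_trichotomy i c with h | h | h
  · rw [if_neg h.ne]
    simp only [triAdjugate, min_eq_left h.le, max_eq_right h.le, min_eq_left (Nat.succ_le_of_lt h),
      max_eq_right (Nat.succ_le_of_lt h), min_eq_left ((Nat.sub_le i 1).trans h.le),
      max_eq_right ((Nat.sub_le i 1).trans h.le)]
    rw [hl i, Finset.prod_eq_prod_Ico_succ_bot h]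
    rcases i with _ | i
    · simp; ring
    · simp only [Nat.add_sub_cancel, Nat.succ_ne_zero, if_false]
      rw [Finset.prod_eq_prod_Ico_succ_bot (show i < c by omega),
        Finset.prod_eq_prod_Ico_succ_bot h]
      ring
  · subst h
    simp only [triAdjugate, min_self, max_self, min_eq_right (Nat.le_succ i),
      max_eq_left (Nat.le_succ i), min_eq_left (Nat.sub_le i 1), max_eq_right (Nat.sub_le i 1),
      Finset.Ico_self, Finset.prod_empty, one_mul, if_true,
      Finset.Ico_eq_empty (show ¬ i + 1 < i by omega)]
    have hs : cont A A E 0 N = cont A A E 0 (i + 1) * cont A A E (i + 1) (N - (i + 1)) -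
        E i * cont A A E 0 i * cont A A E (i + 2) (N - (i + 2)) := by
      rcases hi' : N - (i + 1) with _ | l
      · rw [show N = i + 1 by omega] at hE ⊢
        simp only [Nat.add_sub_cancel] at hE
        simp [hE]
      · have := cont_split A A E l i 0
        rw [show i + 1 + (l + 1) = N by omega] at this
        rw [this, show N - (i + 2) = l by omega]; simp
    rw [hs, hl i]
    rcases i with _ | i
    · simp
    · simp only [Nat.succ_ne_zero, if_false, Nat.add_sub_cancel, Nat.Ico_succ_singleton,
        Finset.prod_singleton]
      ring
  · rw [if_neg h.ne', if_neg (by omega : ¬ i = 0)]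
    simp only [triAdjugate, min_eq_right h.le, max_eq_left h.le,
      min_eq_right (Nat.le_succ_of_le h.le), max_eq_left (Nat.le_succ_of_le h.le),
      min_eq_right (Nat.le_sub_one_of_lt h), max_eq_left (Nat.le_sub_one_of_lt h),
      Finset.Ico_eq_empty (show ¬ i < c by omega), Finset.Ico_eq_empty (show ¬ i + 1 < c by omega),
      Finset.Ico_eq_empty (show ¬ i - 1 < c by omega), Finset.prod_empty]
    rw [show i - 1 + 1 = i by omega, hr i (by omega)]
    ring

end Inverse

section Transfer

variable {N : ℕ} (ε : Fin N → ℝ)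

theorem transfer_eq {M : RatFunc ℝ} (hM : M ≠ 0)
    (hP : cutBlock (fun i => RatFunc.C (innerWeight ε i)) M⁻¹ 1 (N - 1) ≠ 0)
    {c o : Fin N} (hc : (c : ℕ) ≠ 0) (ho : (o : ℕ) ≠ 0) :
    transfer M N ε c o = (∏ i ∈ Finset.Ico (o : ℕ) c, RatFunc.C (innerWeight ε i)) *
      block (fun i => RatFunc.C (innerWeight ε i)) M⁻¹ 1 (min (o : ℕ) c - 1) *
      cutBlock (fun i => RatFunc.C (innerWeight ε i)) M⁻¹ (max (o : ℕ) c + 1)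
        (N - (max (o : ℕ) c + 1)) /
      cutBlock (fun i => RatFunc.C (innerWeight ε i)) M⁻¹ 1 (N - 1) := by
  have hN : 2 ≤ N := by have := c.2; omega
  set E : ℕ → RatFunc ℝ := fun i => RatFunc.C (innerWeight ε i) with hE
  set A : ℕ → RatFunc ℝ := fun i => if i = 0 then M⁻¹ else M⁻¹ + (1 + E i) with hA
  have hE0 : E 0 = 0 := by simp [hE, innerWeight_zero]
  have hEN : E (N - 1) = 0 := by simp [hE, innerWeight_of_le ε (show N ≤ N - 1 + 1 by omega)]
  have hA1 : ∀ a i, 1 ≤ a → a ≤ i → A i = M⁻¹ + (1 + E i) := fun a i ha hi => by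
    rw [hA]; exact if_neg (by omega)
  have hblock : ∀ a m, 1 ≤ a → cont A A E a m = block E M⁻¹ a m := fun a m ha =>
    cont_congr _ _ _ _ _ (fun i hi => hA1 a i ha hi) (fun i hi => hA1 a i ha hi) fun _ _ => rfl
  have hlead : ∀ m, cont A A E 0 (m + 1) = M⁻¹ * block E M⁻¹ 1 m := by
    intro m
    rcases m with _ | m
    · simp [hA, block]
    · rw [cont_add_two, hE0, hblock 1 _ le_rfl]; simp [hA]
  have htail : ∀ a, 1 ≤ a → cont A A E a (N - a) = cutBlock E M⁻¹ a (N - a) := by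
    intro a ha
    rw [hblock a _ ha]
    rcases h : N - a with _ | m
    · simp [block, cutBlock]
    · rw [cutBlock_last_eq]
      rw [show a + m = N - 1 by omega, hEN]
  have hdet : cont A A E 0 N = M⁻¹ * cutBlock E M⁻¹ 1 (N - 1) := by
    rw [← htail 1 le_rfl, hblock 1 _ le_rfl, ← hlead, show N - 1 + 1 = N by omega]
  have hdet0 : cont A A E 0 N ≠ 0 := by rw [hdet]; exact mul_ne_zero (inv_ne_zero hM) hP
  have hinv : (1 + M • (laplacian N ε).map RatFunc.C)⁻¹ = Matrix.of fun i j : Fin N =>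
      M⁻¹ * (triAdjugate A E N i j / cont A A E 0 N) := by
    refine Matrix.inv_eq_right_inv ?_
    ext i j
    rw [add_mul, one_mul, Matrix.smul_mul, Matrix.add_apply, Matrix.smul_apply, Matrix.mul_apply]
    simp only [Matrix.map_apply, Matrix.of_apply, smul_eq_mul]
    have hs := sum_laplacian_mul ε (RatFunc.C : ℝ →+* RatFunc ℝ)
      (fun k => M⁻¹ * (triAdjugate A E N k j / cont A A E 0 N)) i
    rw [hs]
    have ht := triAdjugate_spec A E hEN i.2 j.2
    have hm : M * M⁻¹ = 1 := mul_inv_cancel₀ hM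
    have hδ : (if (i : ℕ) = j then cont A A E 0 N else 0) / cont A A E 0 N =
        (1 : Matrix (Fin N) (Fin N) (RatFunc ℝ)) i j := by
      rw [Matrix.one_apply]
      by_cases hij : i = j
      · rw [if_pos hij, if_pos (by rw [hij]), div_self hdet0]
      · rw [if_neg hij, if_neg (fun h => hij (Fin.ext h)), zero_div]
    rw [← hδ, ← ht]
    by_cases h0 : (i : ℕ) = 0
    · have hA0 : A i = M⁻¹ := by rw [hA]; exact if_pos h0
      have hEi : E i = 0 := by rw [h0]; exact hE0
      rw [if_pos h0, if_pos h0, hA0, hEi]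
      ring
    · have hAi : A i = M⁻¹ + (1 + E i) := hA1 1 i le_rfl (by omega)
      rw [if_neg h0, if_neg h0, hAi, show RatFunc.C (innerWeight ε i) = E i from rfl]
      generalize M⁻¹ = W at hm ⊢
      generalize cont A A E 0 N = D
      linear_combination ((1 + E i) * (triAdjugate A E N i j / D) -
        triAdjugate A E N (i - 1) j / D - E i * (triAdjugate A E N (i + 1) j / D)) * hm
  rw [transfer, transferMatrix, hinv, Matrix.smul_apply, Matrix.of_apply, smul_eq_mul,
    ← mul_assoc, mul_inv_cancel₀ hM, one_mul, triAdjugate, hdet, htail _ (by omega),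
    show min (o : ℕ) c = min (o : ℕ) c - 1 + 1 by omega, hlead, Nat.add_sub_cancel]
  have : M⁻¹ ≠ 0 := inv_ne_zero hM
  field_simp

end Transfer


/-! ### Values of rational functions -/

section EvalsTo

variable {L : Type} [Field L] (f : ℝ →+* L) (a : L)

/-- The rational function `x` has no pole at `a` and takes the value `v` there. -/
def EvalsTo (x : RatFunc ℝ) (v : L) : Prop :=
  x.denom.eval₂ f a ≠ 0 ∧ x.eval f a = v

variable {f a} {x y : RatFunc ℝ} {u v : L}

theorem EvalsTo.of_dvd {q : ℝ[X]} (h : x.denom ∣ q) (hq : q.eval₂ f a ≠ 0) :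
    EvalsTo f a x (x.eval f a) := by
  refine ⟨fun h0 => hq ?_, rfl⟩
  obtain ⟨r, rfl⟩ := h
  rw [Polynomial.eval₂_mul, h0, zero_mul]

theorem EvalsTo.algebraMap (p : ℝ[X]) :
    EvalsTo f a (algebraMap ℝ[X] (RatFunc ℝ) p) (p.eval₂ f a) := by
  refine ⟨?_, ?_⟩
  · rw [RatFunc.denom_algebraMap]; simp
  · rw [RatFunc.eval_algebraMap]; simp

theorem EvalsTo.C (r : ℝ) : EvalsTo f a (RatFunc.C r) (f r) := by
  refine ⟨?_, RatFunc.eval_C f a⟩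
  rw [RatFunc.denom_C]; simp

theorem EvalsTo.add (hx : EvalsTo f a x u) (hy : EvalsTo f a y v) :
    EvalsTo f a (x + y) (u + v) := by
  have := EvalsTo.of_dvd (f := f) (a := a) (RatFunc.denom_add_dvd x y)
    (by rw [Polynomial.eval₂_mul]; exact mul_ne_zero hx.1 hy.1)
  rwa [RatFunc.eval_add f a hx.1 hy.1, hx.2, hy.2] at this

theorem EvalsTo.mul (hx : EvalsTo f a x u) (hy : EvalsTo f a y v) :
    EvalsTo f a (x * y) (u * v) := by
  have := EvalsTo.of_dvd (f := f) (a := a) (RatFunc.denom_mul_dvd x y)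
    (by rw [Polynomial.eval₂_mul]; exact mul_ne_zero hx.1 hy.1)
  rwa [RatFunc.eval_mul f a hx.1 hy.1, hx.2, hy.2] at this

theorem EvalsTo.sub (hx : EvalsTo f a x u) (hy : EvalsTo f a y v) :
    EvalsTo f a (x - y) (u - v) := by
  have := hx.add ((EvalsTo.C (f := f) (a := a) (-1)).mul hy)
  simpa [sub_eq_add_neg] using this

theorem EvalsTo.ne_zero (hx : EvalsTo f a x u) (hu : u ≠ 0) : x ≠ 0 := by
  rintro rfl
  exact hu (by rw [← hx.2, RatFunc.eval_zero])

theorem EvalsTo.inv (hx : EvalsTo f a x u) (hu : u ≠ 0) : EvalsTo f a x⁻¹ u⁻¹ := by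
  have h0 := hx.ne_zero hu
  have hn : x.num.eval₂ f a ≠ 0 := fun h => hu (by rw [← hx.2, RatFunc.eval, h, zero_div])
  have h1 := EvalsTo.of_dvd (RatFunc.denom_inv_dvd h0) hn
  have h2 := (hx.mul h1).2
  rw [mul_inv_cancel₀ h0, RatFunc.eval_one] at h2
  rwa [eq_inv_of_mul_eq_one_right h2.symm] at h1

theorem EvalsTo.div (hx : EvalsTo f a x u) (hy : EvalsTo f a y v) (hv : v ≠ 0) :
    EvalsTo f a (x / y) (u / v) := by
  rw [div_eq_mul_inv, div_eq_mul_inv]; exact hx.mul (hy.inv hv)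

theorem EvalsTo.cont {A Z E : ℕ → RatFunc ℝ} {A' Z' E' : ℕ → L}
    (hA : ∀ i, EvalsTo f a (A i) (A' i)) (hZ : ∀ i, EvalsTo f a (Z i) (Z' i))
    (hE : ∀ i, EvalsTo f a (E i) (E' i)) (m : ℕ) : ∀ i,
    EvalsTo f a (cont A Z E i m) (Platoon.cont A' Z' E' i m) := by
  have h1 : EvalsTo f a 1 1 := by simpa using EvalsTo.C (f := f) (a := a) 1
  induction m using two_step_induction with
  | h0 => intro i; simpa using h1
  | h1 => intro i; simpa using hZ i
  | h m ih0 ih1 =>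
    intro i
    rw [cont_add_two, cont_add_two]
    exact ((hA i).mul (ih1 _)).sub ((hE i).mul (ih0 _))

theorem EvalsTo.cutBlock (hx : EvalsTo f a x u) (e : ℕ → ℝ) (i m : ℕ) :
    EvalsTo f a (cutBlock (fun i => RatFunc.C (e i)) x i m)
      (Platoon.cutBlock (fun i => f (e i)) u i m) := by
  have h1 : EvalsTo f a 1 1 := by simpa using EvalsTo.C (f := f) (a := a) 1
  exact EvalsTo.cont (fun i => hx.add (h1.add (EvalsTo.C _))) (fun _ => hx.add h1)
    (fun i => EvalsTo.C _) m i

theorem EvalsTo.block (hx : EvalsTo f a x u) (e : ℕ → ℝ) (i m : ℕ) :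
    EvalsTo f a (block (fun i => RatFunc.C (e i)) x i m)
      (Platoon.block (fun i => f (e i)) u i m) := by
  have h1 : EvalsTo f a 1 1 := by simpa using EvalsTo.C (f := f) (a := a) 1
  exact EvalsTo.cont (fun i => hx.add (h1.add (EvalsTo.C _)))
    (fun i => hx.add (h1.add (EvalsTo.C _))) (fun i => EvalsTo.C _) m i

theorem EvalsTo.inv_of_num {M : RatFunc ℝ} (hn : M.num.eval₂ f a ≠ 0) :
    EvalsTo f a M⁻¹ (M.denom.eval₂ f a / M.num.eval₂ f a) := by
  have := (EvalsTo.algebraMap (f := f) (a := a) M.denom).div (EvalsTo.algebraMap M.num) hn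
  rwa [← inv_div, RatFunc.num_div_denom] at this

/-- The value of a transfer function at a point where `M⁻¹` takes the value `u`. -/
theorem evalsTo_transfer {N : ℕ} (ε : Fin N → ℝ) {M : RatFunc ℝ} (hM : M ≠ 0)
    (hx : EvalsTo f a M⁻¹ u)
    (hP : Platoon.cutBlock (fun i => f (innerWeight ε i)) u 1 (N - 1) ≠ 0)
    {c o : Fin N} (hc : (c : ℕ) ≠ 0) (ho : (o : ℕ) ≠ 0) :
    EvalsTo f a (transfer M N ε c o) (f (∏ i ∈ Finset.Ico (o : ℕ) c, innerWeight ε i) *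
      Platoon.block (fun i => f (innerWeight ε i)) u 1 (min (o : ℕ) c - 1) *
      Platoon.cutBlock (fun i => f (innerWeight ε i)) u (max (o : ℕ) c + 1)
        (N - (max (o : ℕ) c + 1)) /
      Platoon.cutBlock (fun i => f (innerWeight ε i)) u 1 (N - 1)) := by
  have h1 := hx.cutBlock (innerWeight ε) 1 (N - 1)
  rw [transfer_eq ε hM (h1.ne_zero hP) hc ho, ← map_prod]
  exact (((EvalsTo.C _).mul (hx.block _ _ _)).mul (hx.cutBlock _ _ _)).div h1 hP

end EvalsTo

/-! ### The single-agent closed loop -/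

section ClosedLoop

open Polynomial

theorem numIntegrators_pos_iff {M : RatFunc ℝ} :
    1 ≤ numIntegrators M ↔ M.denom.eval 0 = 0 := by
  rw [numIntegrators, Nat.succ_le_iff, rootMultiplicity_pos M.denom_ne_zero, IsRoot]

theorem num_eval_zero_ne {M : RatFunc ℝ} (h : M.denom.eval 0 = 0) : M.num.eval 0 ≠ 0 := by
  intro h0
  obtain ⟨a, b, hab⟩ := M.isCoprime_num_denom
  have := congrArg (eval 0) hab
  simp [h, h0] at this

theorem evalAt_closedLoop {M : RatFunc ℝ} {k : ℝ} {s : ℂ}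
    (h : aeval s (M.denom + C k * M.num) ≠ 0) :
    evalAt (closedLoop M k) s = aeval s (C k * M.num) / aeval s (M.denom + C k * M.num) := by
  have hd : algebraMap ℝ[X] (RatFunc ℝ) M.denom ≠ 0 := RatFunc.algebraMap_ne_zero M.denom_ne_zero
  have h0 : M.denom + C k * M.num ≠ 0 := fun h0 => h (by rw [h0, map_zero])
  have h1 : closedLoop M k = algebraMap ℝ[X] (RatFunc ℝ) (C k * M.num) /
      algebraMap ℝ[X] (RatFunc ℝ) (M.denom + C k * M.num) := by
    have h2 := RatFunc.algebraMap_ne_zero h0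
    have hM := M.num_div_denom
    rw [map_add, map_mul, RatFunc.algebraMap_C] at *
    rw [closedLoop]
    conv_lhs => rw [← hM]
    rw [show 1 + RatFunc.C k * (algebraMap ℝ[X] (RatFunc ℝ) M.num /
      algebraMap ℝ[X] (RatFunc ℝ) M.denom) = (algebraMap ℝ[X] (RatFunc ℝ) M.denom +
      RatFunc.C k * algebraMap ℝ[X] (RatFunc ℝ) M.num) / algebraMap ℝ[X] (RatFunc ℝ) M.denom by
        field_simp]
    field_simp
  rw [evalAt, h1]
  exact ((EvalsTo.algebraMap _).div (EvalsTo.algebraMap _) h).2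

theorem one_lt_hinfNorm_closedLoop {M : RatFunc ℝ} {k : ℝ}
    (hst : IsStable (M.denom + C k * M.num)) :
    1 < hinfNorm (closedLoop M k) ↔ ∃ ω : ℝ, 0 ≤ ω ∧
      ‖aeval (Complex.I * ω) (M.denom + C k * M.num)‖ < ‖aeval (Complex.I * ω) (C k * M.num)‖ := by
  simp only [hinfNorm, lt_iSup_iff, exists_prop]
  refine exists_congr fun ω => and_congr_right fun _ => ?_
  have h0 : aeval (Complex.I * ω) (M.denom + C k * M.num) ≠ 0 := fun h => by
    have := hst _ h
    simp at this
  rw [evalAt_closedLoop h0, ← ofReal_norm, ← ENNReal.ofReal_one, ENNReal.ofReal_lt_ofReal_iff',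
    norm_div, one_lt_div (norm_pos_iff.2 h0)]
  refine and_iff_left_of_imp fun h => div_pos ((norm_nonneg _).trans_lt h) (norm_pos_iff.2 h0)

theorem aeval_neg_I_mul (p : ℝ[X]) (ω : ℝ) :
    aeval (Complex.I * ((-ω : ℝ) : ℂ)) p = starRingEnd ℂ (aeval (Complex.I * (ω : ℂ)) p) := by
  rw [← aeval_conj]; simp

/-- Maximum modulus principle for the quotient of two polynomials on the right half-plane. -/
theorem norm_le_norm_of_stable {p q : ℝ[X]} (hq : IsStable q) (hp : p ≠ 0)
    (h : ∀ ω : ℝ, 0 ≤ ω → ‖aeval (Complex.I * ω) p‖ ≤ ‖aeval (Complex.I * ω) q‖)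
    {z : ℂ} (hz : 0 ≤ z.re) : ‖aeval z p‖ ≤ ‖aeval z q‖ := by
  have hq0 : ∀ s : ℂ, 0 ≤ s.re → aeval s q ≠ 0 := fun s hs h0 => absurd (hq s h0) (not_lt.2 hs)
  have hall : ∀ ω : ℝ, ‖aeval (Complex.I * ω) p‖ ≤ ‖aeval (Complex.I * ω) q‖ := by
    intro ω
    rcases le_total 0 ω with hω | hω
    · exact h ω hω
    · have := h (-ω) (by linarith)
      rwa [aeval_neg_I_mul, aeval_neg_I_mul, RCLike.norm_conj, RCLike.norm_conj] at this
  have hev : ∀ (r : ℝ[X]) (s : ℂ), (r.map (algebraMap ℝ ℂ)).eval s = aeval s r := fun r s => by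
    rw [eval_map_algebraMap]
  have hI : Filter.Tendsto (fun ω : ℝ => Complex.I * (ω : ℂ)) Filter.atTop
      (Bornology.cobounded ℂ) := by
    rw [← tendsto_norm_atTop_iff_cobounded]
    simpa using Filter.tendsto_abs_atTop_atTop
  -- otherwise `q = o(p)` at infinity along the imaginary axis
  have hdeg : (p.map (algebraMap ℝ ℂ)).degree ≤ (q.map (algebraMap ℝ ℂ)).degree := by
    by_contra hlt
    have ho := (isLittleO_cobounded_of_degree_lt (not_le.1 hlt)).comp_tendsto hI
    have h1 := ho.bound (show (0 : ℝ) < 1 / 2 by norm_num)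
    have h2 : ∀ᶠ ω : ℝ in Filter.atTop, (p.map (algebraMap ℝ ℂ)).eval (Complex.I * (ω : ℂ)) ≠ 0 := by
      have hpm : p.map (algebraMap ℝ ℂ) ≠ 0 := (Polynomial.map_ne_zero_iff
        (algebraMap ℝ ℂ).injective).2 hp
      have hf : {s : ℂ | (p.map (algebraMap ℝ ℂ)).IsRoot s}.Finite := finite_setOfPred_isRoot hpm
      have := hI.eventually (Bornology.isBounded_def.1 hf.isBounded)
      exact this
    obtain ⟨ω, h3, h4⟩ := (h1.and h2).exists
    simp only [Function.comp, hev] at h3 h4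
    have h5 := hall ω
    have h6 := norm_pos_iff.2 h4
    linarith
  have hb := isBigO_cobounded_of_degree_le hdeg
  set f : ℂ → ℂ := fun s => aeval s p / aeval s q with hf
  have hbd : f =O[Bornology.cobounded ℂ ⊓ Filter.principal {z | 0 < z.re}]
      fun _ => (1 : ℝ) := by
    obtain ⟨C, hC⟩ := hb.bound
    refine Asymptotics.IsBigO.of_bound C ?_
    rw [Filter.eventually_inf_principal]
    filter_upwards [hC] with s hs hre
    simp only [hev] at hs
    rw [hf]
    simp only [norm_div, norm_one, mul_one]
    rwa [div_le_iff₀ (norm_pos_iff.2 (hq0 s (le_of_lt hre)))]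
  have key : ‖f z‖ ≤ 1 := by
    refine PhragmenLindelof.right_half_plane_of_bounded_on_real (f := f) (C := 1) ?_
      ⟨0, by norm_num, 0, by simpa using hbd⟩ ?_ ?_ hz
    · refine DifferentiableOn.diffContOnCl fun s hs => ?_
      have hs' : 0 ≤ s.re := by
        rw [Complex.closure_setOfPred_lt_re] at hs; exact hs
      exact ((p.differentiable_aeval s).div (q.differentiable_aeval s)
        (hq0 s hs')).differentiableWithinAt
    · obtain ⟨C, hC⟩ := hbd.bound
      refine ⟨C, ?_⟩
      rw [Filter.eventually_map]
      have ht : Filter.Tendsto (fun x : ℝ => (x : ℂ)) Filter.atTop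
          (Bornology.cobounded ℂ ⊓ Filter.principal {z | 0 < z.re}) := by
        refine Filter.tendsto_inf.2 ⟨?_, ?_⟩
        · rw [← tendsto_norm_atTop_iff_cobounded]
          simpa using Filter.tendsto_abs_atTop_atTop
        · refine Filter.tendsto_principal.2 ?_
          filter_upwards [Filter.eventually_gt_atTop (0 : ℝ)] with x hx
          simpa using hx
      simpa using ht.eventually hC
    · intro x
      rw [hf]
      simp only [norm_div]
      rw [div_le_one (norm_pos_iff.2 (hq0 _ (by simp))), mul_comm]
      exact hall x
  rw [hf] at key
  simp only [norm_div] at key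
  rwa [div_le_one (norm_pos_iff.2 (hq0 z hz))] at key

/-- With at least two integrators `T = k M / (1 + k M)` satisfies `T - 1 ~ c s ^ η` at `0` with
`η ≥ 2` and `c ≠ 0` real, so that `|T| > 1` in some directions of the closed right half-plane; by
the maximum modulus principle `|T| > 1` somewhere on the imaginary axis. -/
theorem one_lt_hinfNorm_of_two_le {M : RatFunc ℝ} {k : ℝ} (hk : 0 < k)
    (hst : IsStable (M.denom + C k * M.num)) (hint : 2 ≤ numIntegrators M) :
    1 < hinfNorm (closedLoop M k) := by
  rw [one_lt_hinfNorm_closedLoop hst]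
  by_contra! hcon
  have hd0 := numIntegrators_pos_iff.1 (le_trans (by norm_num) hint)
  have hn0 := num_eval_zero_ne hd0
  have hmax : ∀ z : ℂ, 0 ≤ z.re →
      ‖aeval z (C k * M.num)‖ ≤ ‖aeval z (M.denom + C k * M.num)‖ := fun z hz =>
    norm_le_norm_of_stable hst (mul_ne_zero (C_ne_zero.2 hk.ne')
      (fun h => hn0 (by rw [h, eval_zero]))) hcon hz
  set η := numIntegrators M with hη
  obtain ⟨e, he, hne⟩ := exists_eq_pow_rootMultiplicity_mul_and_not_dvd M.denom M.denom_ne_zero 0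
  change M.denom = (X - C 0) ^ η * e at he
  rw [C_0, sub_zero] at he hne
  have he0 : e.eval 0 ≠ 0 := fun h => hne (X_dvd_iff.2 (by rwa [coeff_zero_eq_eval_zero]))
  have key : ∀ (u : ℂ) (σ : ℝ), 0 ≤ u.re → u ^ η = σ → 0 ≤ σ * (e.eval 0 * M.num.eval 0) := by
    intro u σ hu hσ
    set F : ℝ → ℝ := fun r => r ^ η * ‖(σ : ℂ) * aeval (r * u) e‖ ^ 2 +
      2 * ((σ : ℂ) * aeval (r * u) e * starRingEnd ℂ (aeval (r * u) (C k * M.num))).re with hF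
    have hpoly : ∀ p : ℝ[X], Continuous fun r : ℝ => aeval ((r : ℂ) * u) p := fun p =>
      p.continuous_aeval.comp (by fun_prop)
    have hFc : Continuous F := by
      have h1 := hpoly e
      have h2 := hpoly (C k * M.num)
      have h3 : Continuous fun r : ℝ => starRingEnd ℂ (aeval ((r : ℂ) * u) (C k * M.num)) :=
        Complex.continuous_conj.comp h2
      exact ((continuous_pow η).mul ((continuous_const.mul h1).norm.pow 2)).add
        (continuous_const.mul (Complex.continuous_re.comp ((continuous_const.mul h1).mul h3)))
    -- `F r` is `(|d + k n| ^ 2 - |k n| ^ 2) / r ^ η` at `r u`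
    have hFpos : ∀ r : ℝ, 0 < r → 0 ≤ F r := by
      intro r hr
      have h1 := hmax (r * u) (by simpa using mul_nonneg hr.le hu)
      have h2 : aeval ((r : ℂ) * u) M.denom = r ^ η * (σ * aeval ((r : ℂ) * u) e) := by
        rw [he, map_mul, map_pow, aeval_X, mul_pow, hσ, mul_assoc]
      rw [map_add, h2] at h1
      set E := (σ : ℂ) * aeval ((r : ℂ) * u) e with hE
      set n := aeval ((r : ℂ) * u) (C k * M.num) with hn
      have h3 : ‖n‖ ^ 2 ≤ ‖(r : ℂ) ^ η * E + n‖ ^ 2 := pow_le_pow_left₀ (norm_nonneg _) h1 2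
      rw [← Complex.normSq_eq_norm_sq, ← Complex.normSq_eq_norm_sq, Complex.normSq_add,
        map_mul, show Complex.normSq ((r : ℂ) ^ η) = r ^ η * r ^ η by
          rw [← Complex.ofReal_pow, Complex.normSq_ofReal], mul_assoc ((r : ℂ) ^ η) E,
        ← Complex.ofReal_pow, Complex.re_ofReal_mul, Complex.normSq_eq_norm_sq E] at h3
      have h4 : 0 ≤ r ^ η * F r := by rw [hF]; simp only; linarith
      exact nonneg_of_mul_nonneg_right h4 (pow_pos hr η)
    have hF0 : 0 ≤ F 0 := ge_of_tendsto (hFc.continuousWithinAt (s := Set.Ioi 0) (x := 0))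
      (Filter.eventually_of_mem self_mem_nhdsWithin fun r hr => hFpos r hr)
    have ha : ∀ p : ℝ[X], aeval (0 : ℂ) p = ((p.eval 0 : ℝ) : ℂ) := fun p => by
      have := aeval_algebraMap_apply ℂ (0 : ℝ) p
      simpa using this
    have hη0 : η ≠ 0 := by omega
    rw [hF] at hF0
    simp only [Complex.ofReal_zero, zero_mul, zero_pow hη0, zero_add, ha, Complex.conj_ofReal,
      ← Complex.ofReal_mul, Complex.ofReal_re, eval_mul, eval_C] at hF0
    by_contra hneg
    nlinarith [mul_pos hk (neg_pos.2 (not_le.1 hneg))]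
  have h1 := key 1 1 (by simp) (by simp)
  have hη0 : (η : ℝ) ≠ 0 := by
    have : η ≠ 0 := by omega
    exact_mod_cast this
  -- in the direction `exp (iπ / η)`, which lies in the half-plane as `η ≥ 2`, the sign is opposite
  have h2 := key (Complex.exp ((Real.pi / η : ℝ) * Complex.I)) (-1) (by
      rw [Complex.exp_ofReal_mul_I_re]
      have hη2 : (2 : ℝ) ≤ η := by exact_mod_cast hint
      refine Real.cos_nonneg_of_neg_pi_div_two_le_of_le ?_ ?_
      · have : 0 ≤ Real.pi / η := by positivity
        linarith [Real.pi_pos]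
      · exact div_le_div_of_nonneg_left Real.pi_pos.le (by norm_num) hη2) (by
      rw [← Complex.exp_nat_mul, ← mul_assoc, ← Complex.ofReal_natCast, ← Complex.ofReal_mul,
        mul_div_cancel₀ _ hη0, Complex.exp_pi_mul_I]
      simp)
  have h3 : e.eval 0 * M.num.eval 0 = 0 := by linarith
  exact mul_ne_zero he0 hn0 h3

end ClosedLoop


/-! ### Choice of the frequency -/

section Frequency

open Polynomial

/-- A stable polynomial with `p(-s)` divisible by `p(s)` is constant. -/
theorem eq_C_of_stable_of_dvd_comp_neg {p : ℝ[X]} (hp : IsStable p) (h : p ∣ p.comp (-X)) :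
    ∃ a, p = C a := by
  refine ⟨p.coeff 0, eq_C_of_degree_le_zero ?_⟩
  by_contra hdeg
  obtain ⟨z, hz⟩ := IsAlgClosed.exists_aeval_eq_zero ℂ p (fun h0 => hdeg h0.le)
  have h1 := hp z hz
  have h2 : aeval (-z) p = 0 := by
    obtain ⟨c, hc⟩ := h
    have := congrArg (aeval z) hc
    rw [map_mul, hz, zero_mul, aeval_comp] at this
    simpa using this
  have h3 := hp (-z) h2
  rw [Complex.neg_re] at h3
  linarith

/-- If `d / n` takes real values on the imaginary axis, it is even, and so are, up to a sign, the
polynomials `d + l n`; only one of them can be stable, as the stable ones are constant. -/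
theorem eq_of_even_of_stable {d n : ℝ[X]} (hcop : IsCoprime n d) (hd : d ≠ 0)
    (hd0 : d.eval 0 = 0) (heven : d * n.comp (-X) - d.comp (-X) * n = 0) {k l : ℝ}
    (hk : IsStable (d + C k * n)) (hl : IsStable (d + C l * n)) : k = l := by
  have h1 : d ∣ d.comp (-X) := by
    refine hcop.symm.dvd_of_dvd_mul_right (z := n) ?_
    rw [← sub_eq_zero.1 heven]
    exact dvd_mul_right _ _
  obtain ⟨c, hc⟩ := h1
  have h2 : n.comp (-X) = c * n := by
    refine mul_left_cancel₀ hd ?_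
    rw [sub_eq_zero.1 heven, hc]; ring
  have h3 : ∀ r : ℝ, d + C r * n ∣ (d + C r * n).comp (-X) := fun r => ⟨c, by
    rw [add_comp, mul_comp, C_comp, hc, h2]; ring⟩
  obtain ⟨a, ha⟩ := eq_C_of_stable_of_dvd_comp_neg hk (h3 k)
  obtain ⟨b, hb⟩ := eq_C_of_stable_of_dvd_comp_neg hl (h3 l)
  by_contra hne
  have hkl : k - l ≠ 0 := sub_ne_zero.2 hne
  have e1 : C (k - l) * d = C (k * b - l * a) := by
    have : C k * (d + C l * n) - C l * (d + C k * n) = C (k - l) * d := by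
      rw [C_sub]; ring
    rw [← this, ha, hb]; simp
  have e2 := congrArg (eval 0) e1
  rw [eval_mul, hd0, mul_zero, eval_C] at e2
  rw [← e2, C_0] at e1
  exact (mul_ne_zero (C_ne_zero.2 hkl) hd) e1

/-- A frequency with `|T_min| > 1` in terms of `w = 1 / M`: as `T_min = lmin / (w + lmin)`, this means
`|w + lmin| < lmin`. -/
theorem exists_frequency {M : RatFunc ℝ} {lmin lmax : ℝ} (hpos : 0 < lmin) (hle : lmin ≤ lmax)
    (hint : 1 ≤ numIntegrators M)
    (hstab : ∀ l ∈ Set.Icc lmin lmax, IsStable (M.denom + C l * M.num))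
    (hnorm : 1 < hinfNorm (closedLoop M lmin)) :
    ∃ (ω : ℝ) (w : ℂ), 0 ≤ ω ∧ EvalsTo (algebraMap ℝ ℂ) (Complex.I * ω) M⁻¹ w ∧
      ‖w + lmin‖ < lmin ∧ w + lmin ≠ 0 ∧ (w.im ≠ 0 ∨ lmin = lmax) := by
  have hst := hstab lmin ⟨le_rfl, hle⟩
  have hd0 := numIntegrators_pos_iff.1 hint
  have hn0 := num_eval_zero_ne hd0
  have hn : M.num ≠ 0 := fun h => hn0 (by rw [h, eval_zero])
  obtain ⟨ω₀, hω₀, hlt⟩ := (one_lt_hinfNorm_closedLoop hst).1 hnorm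
  have hc : ∀ p : ℝ[X], Continuous fun ω : ℝ => ‖aeval (Complex.I * (ω : ℂ)) p‖ := fun p =>
    (p.continuous_aeval.comp (by fun_prop)).norm
  have hopen : IsOpen {ω : ℝ | ‖aeval (Complex.I * ω) (M.denom + C lmin * M.num)‖ <
      ‖aeval (Complex.I * ω) (C lmin * M.num)‖} := isOpen_lt (hc _) (hc _)
  obtain ⟨r, hr, hball⟩ := Metric.isOpen_iff.1 hopen ω₀ hlt
  have hfin : ∀ p : ℝ[X], p ≠ 0 → {ω : ℝ | aeval (Complex.I * (ω : ℂ)) p = 0}.Finite := by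
    intro p hp
    have hpm : p.map (algebraMap ℝ ℂ) ≠ 0 :=
      (Polynomial.map_ne_zero_iff (algebraMap ℝ ℂ).injective).2 hp
    have h1 := finite_setOfPred_isRoot hpm
    refine (h1.preimage (f := fun ω : ℝ => Complex.I * (ω : ℂ)) ?_).subset ?_
    · intro x _ y _ hxy
      simpa using hxy
    · intro ω hω
      change (p.map (algebraMap ℝ ℂ)).eval (Complex.I * (ω : ℂ)) = 0
      rw [eval_map_algebraMap]; exact hω
  -- every frequency slightly above `ω₀` that is not a zero of `p` will do
  have hex : ∀ p : ℝ[X], p ≠ 0 → ∃ ω : ℝ, 0 ≤ ω ∧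
      ‖aeval (Complex.I * ω) (M.denom + C lmin * M.num)‖ <
        ‖aeval (Complex.I * ω) (C lmin * M.num)‖ ∧ aeval (Complex.I * (ω : ℂ)) p ≠ 0 := by
    intro p hp
    obtain ⟨ω, hω, hnot⟩ := (Set.Ioo_infinite (show ω₀ < ω₀ + r by linarith)).exists_notMem_finite
      (hfin p hp)
    refine ⟨ω, hω₀.trans hω.1.le, hball ?_, hnot⟩
    rw [Metric.mem_ball, Real.dist_eq, abs_lt]
    constructor <;> linarith [hω.1, hω.2]
  have main : ∀ ω : ℝ, ‖aeval (Complex.I * ω) (M.denom + C lmin * M.num)‖ <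
        ‖aeval (Complex.I * ω) (C lmin * M.num)‖ → aeval (Complex.I * (ω : ℂ)) M.num ≠ 0 →
      EvalsTo (algebraMap ℝ ℂ) (Complex.I * ω) M⁻¹
          (aeval (Complex.I * (ω : ℂ)) M.denom / aeval (Complex.I * (ω : ℂ)) M.num) ∧
        ‖aeval (Complex.I * (ω : ℂ)) M.denom / aeval (Complex.I * (ω : ℂ)) M.num + lmin‖ < lmin ∧
        aeval (Complex.I * (ω : ℂ)) M.denom / aeval (Complex.I * (ω : ℂ)) M.num + lmin ≠ 0 := by
    intro ω hω hne
    have hq0 : aeval (Complex.I * (ω : ℂ)) (M.denom + C lmin * M.num) ≠ 0 := fun h => by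
      have := hst _ h
      simp at this
    have he : aeval (Complex.I * (ω : ℂ)) M.denom / aeval (Complex.I * (ω : ℂ)) M.num + lmin =
        aeval (Complex.I * (ω : ℂ)) (M.denom + C lmin * M.num) /
          aeval (Complex.I * (ω : ℂ)) M.num := by
      rw [map_add, map_mul, aeval_C, Complex.coe_algebraMap]
      field_simp
    refine ⟨EvalsTo.inv_of_num hne, ?_, ?_⟩
    · rw [he, norm_div, div_lt_iff₀ (norm_pos_iff.2 hne)]
      rw [map_mul, aeval_C, Complex.coe_algebraMap, norm_mul, Complex.norm_real,
        Real.norm_of_nonneg hpos.le] at hω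
      exact hω
    · rw [he]; exact div_ne_zero hq0 hne
  by_cases heven : M.denom * M.num.comp (-X) - M.denom.comp (-X) * M.num = 0
  · obtain ⟨ω, h1, h2, h3⟩ := hex M.num hn
    obtain ⟨h4, h5, h6⟩ := main ω h2 h3
    exact ⟨ω, _, h1, h4, h5, h6, Or.inr (eq_of_even_of_stable M.isCoprime_num_denom
      M.denom_ne_zero hd0 heven hst (hstab lmax ⟨hle, le_rfl⟩))⟩
  · obtain ⟨ω, h1, h2, h3⟩ := hex (M.num * (M.denom * M.num.comp (-X) -
      M.denom.comp (-X) * M.num)) (mul_ne_zero hn heven)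
    rw [map_mul] at h3
    have hne := left_ne_zero_of_mul h3
    obtain ⟨h4, h5, h6⟩ := main ω h2 hne
    refine ⟨ω, _, h1, h4, h5, h6, Or.inl fun him => right_ne_zero_of_mul h3 ?_⟩
    have hcj := Complex.conj_eq_iff_im.2 him
    have hI : ∀ p : ℝ[X], aeval (Complex.I * (ω : ℂ)) (p.comp (-X)) =
        starRingEnd ℂ (aeval (Complex.I * (ω : ℂ)) p) := fun p => by
      rw [← aeval_neg_I_mul, aeval_comp]; simp
    rw [map_div₀, div_eq_div_iff ((_root_.map_ne_zero _).2 hne) hne] at hcj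
    rw [map_sub, map_mul, map_mul, hI, hI, hcj, sub_self]

end Frequency

end Platoon

/-! ### Growth of the norm with the distance -/

theorem theorem2 (M : RatFunc ℝ) (lmin lmax : ℝ)
    (hpos : 0 < lmin) (hle : lmin ≤ lmax)
    -- at least one integrator in the open loop
    (hint : 1 ≤ Platoon.numIntegrators M)
    -- asymptotic stability for every gain in `[lmin, lmax]`
    (hstab : ∀ l ∈ Set.Icc lmin lmax, Platoon.IsStable (M.denom + Polynomial.C l * M.num)) :
    (2 ≤ Platoon.numIntegrators M → 1 < Platoon.hinfNorm (Platoon.closedLoop M lmin)) ∧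
    (1 < Platoon.hinfNorm (Platoon.closedLoop M lmin) →
      ∃ ξ ζ : ℝ, 0 < ξ ∧ ξ ≤ 1 ∧ 1 < ζ ∧
        ∀ (N : ℕ) (ε : Fin N → ℝ), (∀ i, 0 ≤ ε i) →
          -- the nonzero eigenvalues of the Laplacian lie in `[lmin, lmax]`
          (∀ l : ℝ, Module.End.HasEigenvalue (Matrix.toLin' (Platoon.laplacian N ε)) l →
            l ≠ 0 → l ∈ Set.Icc lmin lmax) →
          -- `c` and `o` are not the leader, and the path from `c` to `o` has nonzero weight
          ∀ c o : Fin N, (c : ℕ) ≠ 0 → (o : ℕ) ≠ 0 → (∀ i, o ≤ i → i < c → 0 < ε i) →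
            ENNReal.ofReal (ζ ^ Platoon.graphDist c o *
                Platoon.steadyStateGain (Platoon.transfer M N ε c o) * ξ ^ 2) <
              Platoon.hinfNorm (Platoon.transfer M N ε c o)) := by
  open Platoon in
  refine ⟨one_lt_hinfNorm_of_two_le hpos (hstab lmin ⟨le_rfl, hle⟩), fun hnorm => ?_⟩
  obtain ⟨ω, w, hω, hw, hlt, hne, hor⟩ := exists_frequency hpos hle hint hstab hnorm
  have hd0 := numIntegrators_pos_iff.1 hint
  have hn0 := num_eval_zero_ne hd0
  have hM : M ≠ 0 := fun h => hn0 (by rw [h, RatFunc.num_zero, Polynomial.eval_zero])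
  have hmax : 0 < lmax := hpos.trans_le hle
  -- the modulus of all closed loops `l M / (1 + l M)` with `l` in `[lmin, lmax]` is at least `ζ`
  set g := lmin - ‖w + lmin‖ with hg
  have hg0 : 0 < g := sub_pos.2 hlt
  have hg1 : g < lmax := lt_of_lt_of_le (sub_lt_self _ (norm_pos_iff.2 hne)) hle
  set ζ := lmax / (lmax - g) with hζ
  have hζ1 : 1 < ζ := (one_lt_div (by linarith)).2 (by linarith)
  have hζl : ∀ l ∈ Set.Icc lmin lmax, ζ * ‖w + (l : ℂ)‖ ≤ l := by
    intro l hl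
    have h1 : ‖w + (l : ℂ)‖ ≤ l - g := by
      have : w + (l : ℂ) = (w + lmin) + ((l - lmin : ℝ) : ℂ) := by push_cast; ring
      rw [this]
      refine (norm_add_le _ _).trans ?_
      rw [Complex.norm_real, Real.norm_of_nonneg (sub_nonneg.2 hl.1)]
      linarith
    refine (mul_le_mul_of_nonneg_left h1 (by positivity)).trans ?_
    rw [hζ, div_mul_eq_mul_div, div_le_iff₀ (by linarith)]
    nlinarith [hl.2]
  obtain ⟨δ, hδ, hpiv⟩ : ∃ δ : ℝ, 0 < δ ∧ ∀ e : ℕ → ℝ, (∀ i, 0 ≤ e i) →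
      (lmin = lmax → lmin = 1 ∧ ∀ i, e i = 0) → ∃ S, IsPivotSet e w δ S := by
    rcases hor with him | heq
    · exact ⟨|w.im|, abs_pos.2 him, fun e he _ => ⟨_, isPivotSet_of_im_ne_zero he him⟩⟩
    · refine ⟨‖w + lmin‖, norm_pos_iff.2 hne, fun e he h => ?_⟩
      obtain ⟨h1, h2⟩ := h heq
      rw [h1, Complex.ofReal_one] at hne ⊢
      exact ⟨_, isPivotSet_of_eq_zero h2 hne⟩
  set B := (1 + lmax / δ * (1 + 1 / δ)) ^ 2 * (1 + lmax / δ) with hB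
  have hB0 : 0 < B := by positivity
  refine ⟨min 1 (lmin / B), ζ, lt_min one_pos (by positivity), min_le_left _ _, hζ1, ?_⟩
  intro N ε hε heig c o hc ho hpath
  have hcN := c.2
  have hoN := o.2
  have he0 : ∀ i, 0 ≤ innerWeight ε i := innerWeight_nonneg ε hε
  have heN : innerWeight ε (N - 1) = 0 := innerWeight_of_le ε (by omega)
  have hroot : ∀ x : ℝ, cutBlock (innerWeight ε) x 1 (N - 1) = 0 →
      x ∈ Set.Icc (-lmax) (-lmin) := by
    intro x hx
    obtain ⟨h1, h2⟩ := hasEigenvalue_of_cutBlock_eq_zero ε (by omega) (l := -x)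
      (by rwa [neg_neg])
    have h3 := heig _ h1 h2
    exact ⟨by linarith [h3.2], by linarith [h3.1]⟩
  have hbd : ∀ i, 1 ≤ i → i ≤ N - 1 → 1 + innerWeight ε i ≤ lmax := fun i h1 h2 =>
    one_add_le_lmax he0 (innerWeight_bddAbove ε) heN hroot h1 h2
  have hout : ∀ i, ¬ (1 ≤ i ∧ i ≤ N - 1) → innerWeight ε i = 0 := by
    intro i hi
    rcases Nat.eq_zero_or_pos i with rfl | h
    · exact innerWeight_zero ε
    · exact innerWeight_of_le ε (by omega)
  have hb : ∀ i, innerWeight ε i ≤ lmax := by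
    intro i
    by_cases hi : 1 ≤ i ∧ i ≤ N - 1
    · linarith [hbd i hi.1 hi.2]
    · rw [hout i hi]; exact hmax.le
  obtain ⟨S, hS⟩ := hpiv (innerWeight ε) he0 (by
    intro heq
    have h1 := lmin_le_one he0 heN hroot (by omega)
    refine ⟨le_antisymm h1 ?_, fun i => ?_⟩
    · have := hbd (N - 1) (by omega) le_rfl
      linarith
    · by_cases hi : 1 ≤ i ∧ i ≤ N - 1
      · linarith [hbd i hi.1 hi.2, he0 i]
      · exact hout i hi)
  -- `k` vehicles in front of the path, `m` on it and `N - 1 - k - m` behind it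
  obtain ⟨k, hk⟩ : ∃ k, k = min (o : ℕ) c - 1 := ⟨_, rfl⟩
  obtain ⟨m, hm⟩ : ∃ m, m = graphDist c o + 1 := ⟨_, rfl⟩
  obtain ⟨l, hl⟩ : ∃ l, l = N - (max (o : ℕ) c + 1) := ⟨_, rfl⟩
  have hdist : (graphDist c o : ℕ) = max (o : ℕ) c - min (o : ℕ) c := by
    rw [graphDist, Nat.dist]; omega
  have hkml : N - 1 = k + m + l := by omega
  have hkm : max (o : ℕ) c + 1 = 1 + k + m := by omega
  set e := innerWeight ε with he
  set p := ∏ i ∈ Finset.Ico (o : ℕ) c, e i with hp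
  have hp0 : 0 < p := Finset.prod_pos fun i hi => by
    rw [Finset.mem_Ico] at hi
    rw [he, innerWeight, dif_pos ⟨by omega, by omega⟩]
    exact hpath _ (Fin.le_def.2 hi.1) (Fin.lt_def.2 hi.2)
  have hss : steadyStateGain (transfer M N ε c o) = p * block e 0 1 k := by
    have h1 : EvalsTo (RingHom.id ℝ) 0 M⁻¹ 0 := by
      have h := EvalsTo.inv_of_num (f := RingHom.id ℝ) (a := 0) (M := M) hn0
      have hd : M.denom.eval₂ (RingHom.id ℝ) 0 = 0 := hd0
      rwa [hd, zero_div] at h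
    have h2 := evalsTo_transfer ε hM h1 (by
      simp only [RingHom.id_apply]; rw [cutBlock_at_zero]; exact one_ne_zero) hc ho
    simp only [RingHom.id_apply] at h2
    rw [cutBlock_at_zero, cutBlock_at_zero, mul_one, div_one, ← hk] at h2
    exact h2.2
  have hfreq : evalAt (transfer M N ε c o) (Complex.I * ω) =
      p * block (fun i => (e i : ℂ)) w 1 k * cutBlock (fun i => (e i : ℂ)) w (1 + k + m) l /
        cutBlock (fun i => (e i : ℂ)) w 1 (k + m + l) := by
    have h2 := evalsTo_transfer ε hM hw (hS.cutBlock_ne_zero _ _) hc ho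
    simp only [Complex.coe_algebraMap] at h2
    rw [← hk, ← hl, hkm, hkml] at h2
    exact h2.2
  rw [hkml] at heN hroot
  have hmain := pow_mul_block_le he0 hpos (by omega) heN hb hroot hS (by linarith) hζl
  refine lt_of_lt_of_le ?_ (le_iSup₂ (f := fun (ω : ℝ) (_ : 0 ≤ ω) =>
    ‖evalAt (transfer M N ε c o) (Complex.I * (ω : ℂ))‖ₑ) ω hω)
  have hu := block_at_zero_pos he0 1 k
  have hP := norm_pos_iff.2 (hS.cutBlock_ne_zero 1 (k + m + l))
  have hξ : min 1 (lmin / B) ^ 2 ≤ lmin / B := by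
    have h0 : 0 ≤ min 1 (lmin / B) := le_min zero_le_one (by positivity)
    calc _ ≤ min 1 (lmin / B) := pow_le_of_le_one h0 (min_le_left _ _) two_ne_zero
      _ ≤ _ := min_le_right _ _
  have hpow : ζ ^ graphDist c o < ζ ^ m := pow_lt_pow_right₀ hζ1 (by omega)
  have hstep : ζ ^ graphDist c o * steadyStateGain (transfer M N ε c o) * min 1 (lmin / B) ^ 2 <
      ‖evalAt (transfer M N ε c o) (Complex.I * ω)‖ := by
    rw [hss, hfreq, norm_div, norm_mul, norm_mul, Complex.norm_real, Real.norm_of_nonneg hp0.le,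
      lt_div_iff₀ hP]
    calc _ < ζ ^ m * (p * block e 0 1 k) * (lmin / B) *
          ‖cutBlock (fun i => (e i : ℂ)) w 1 (k + m + l)‖ := by
          refine mul_lt_mul_of_pos_right ?_ hP
          exact mul_lt_mul (mul_lt_mul_of_pos_right hpow (by positivity)) hξ
            (pow_pos (lt_min one_pos (by positivity)) 2) (by positivity)
      _ = p / B * (lmin * (ζ ^ m * block e 0 1 k) *
          ‖cutBlock (fun i => (e i : ℂ)) w 1 (k + m + l)‖) := by ring
      _ ≤ p / B * (B * (‖block (fun i => (e i : ℂ)) w 1 k‖ *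
          ‖cutBlock (fun i => (e i : ℂ)) w (1 + k + m) l‖)) :=
          mul_le_mul_of_nonneg_left hmain (by positivity)
      _ = _ := by field_simp
  rw [← ofReal_norm]
  refine (ENNReal.ofReal_lt_ofReal_iff ?_).2 hstep
  refine lt_of_le_of_lt ?_ hstep
  rw [hss]
  positivity
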